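/- Let $(R,\mathfrak m,k)$ be a commutative Noetherian local ring. For a nonzero finitely generated $R$-module $M$ of dimension $d$ put $e_R(M)=d!\lim_{n\to\infty}\ell_R(M/\mathfrak m^nM)/n^d$ (the Hilbert–Samuel multiplicity), and let $\mu_R(M)=\ell_R(M/\mathfrak mM)$ be its minimal number of generators. For a real number $c$, call $M$ $c$-Ulrich if $M$ is a nonzero finitely generated Cohen–Macaulay module (that is, $\operatorname{depth}_R M=\dim_R M$, with $M$ not necessarily of maximal dimension) and $e_R(M)\le c\cdot\mu_R(M)$. For a Noetherian local ring $(A,\mathfrak n)$ let $\operatorname{codim}(A)=\mu_A(\mathfrak n)-\dim A$. Theorem. Let $M$ be a nonzero finitely generated $R$-module that is $c$-Ulrich for some real number $c<1+\frac1v$, where $v=\operatorname{codim}(R/\operatorname{Ann}_R(M))$ and $\frac1v$ is read as $\infty$ if $v=0$. (i) If $k$ is infinite, then there is an $M$-regular sequence $\underline{x}=x_1,\dots,x_r$ in $\mathfrak m$ (possibly empty) such that $k$ is (isomorphic to) a direct summand of $M/\underline{x}M$. (ii) If $N$ is a finitely generated $R$-module and $n\ge 0$ is an integer such that $\operatorname{Ext}^i_R(N,M)=0$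 for all $i=n,\dots,n+\dim_R(M)$, then $\operatorname{pd}_R(N)<\infty$. -/

import Mathlib

open Filter Topology CategoryTheory

universe u

noncomputable section

namespace CUlrich

section Modules

variable (R : Type u) [CommRing R] (M : Type u) [AddCommGroup M] [Module R M]

/-- The dimension of a module (the Krull dimension of its support) as a natural number.
It is the true dimension for a nonzero finitely generated module over a Noetherian local ring;
the zero module gets the value `0`. -/
def dim : ℕ := ((Module.supportDim R M).unbotD 0).toNat

/-- The Hilbert-Samuel multiplicity
`e_R(I, M) = d! * lim_{n → ∞} ℓ_R(M / Iⁿ M) / nᵈ`, `d = dim M`, of `M` with respect to `I`. -/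
def hsMultiplicity (I : Ideal R) : ℝ :=
  (Nat.factorial (dim R M) : ℝ) *
    limUnder atTop (fun n : ℕ =>
      ((Module.length R (M ⧸ (I ^ n • ⊤ : Submodule R M))).toNat : ℝ) / (n : ℝ) ^ dim R M)

/-- The depth of a module over a local ring: the supremum of the lengths of the `M`-regular
sequences contained in the maximal ideal. -/
def depth [IsLocalRing R] : ℕ∞ :=
  ⨆ (rs : List R) (_ : RingTheory.Sequence.IsRegular M rs ∧
    ∀ r ∈ rs, r ∈ IsLocalRing.maximalIdeal R), (rs.length : ℕ∞)

/-- A (nonzero, finitely generated) module over a local ring is Cohen-Macaulay if its depth equals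
its dimension. The zero module does not satisfy this: its depth is `0` and its dimension is `⊥`. -/
def IsCohenMacaulay [IsLocalRing R] : Prop :=
  (depth R M : WithBot ℕ∞) = Module.supportDim R M

/-- `M` is `c`-Ulrich with respect to the ideal `I`: it is Cohen-Macaulay, `M / I M` is free over
`R / I`, and `e_R(I, M) ≤ c * ℓ_R(M / I M)`. -/
structure IsUlrichWithRespectTo [IsLocalRing R] (I : Ideal R) (c : ℝ) : Prop where
  isCohenMacaulay : IsCohenMacaulay R M
  free : Module.Free (R ⧸ I) (M ⧸ (I • ⊤ : Submodule R M))
  multiplicity_le : hsMultiplicity R M I ≤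
    c * ((Module.length R (M ⧸ (I • ⊤ : Submodule R M))).toNat : ℝ)

/-- `M` is `c`-Ulrich: it is `c`-Ulrich with respect to the maximal ideal. -/
def IsUlrich [IsLocalRing R] (c : ℝ) : Prop :=
  IsUlrichWithRespectTo R M (IsLocalRing.maximalIdeal R) c

/-- The module `L` is (isomorphic to) a direct summand of `M`. -/
def IsDirectSummand (L : Type u) [AddCommGroup L] [Module R L] : Prop :=
  ∃ P Q : Submodule R M, IsCompl P Q ∧ Nonempty (L ≃ₗ[R] P)

instance isLocalRing_quotient_annihilator [IsLocalRing R] [Nontrivial M] :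
    IsLocalRing (R ⧸ Module.annihilator R M) :=
  haveI : Nontrivial (R ⧸ Module.annihilator R M) :=
    Ideal.Quotient.nontrivial_iff.mpr fun h =>
      not_subsingleton M (Module.annihilator_eq_top_iff.mp h)
  IsLocalRing.of_surjective' (Ideal.Quotient.mk _) Ideal.Quotient.mk_surjective

end Modules

/-- The codimension `μ(𝔪) - dim A` of a Noetherian local ring `A` with maximal ideal `𝔪`.
The subtraction never truncates, since `dim A ≤ μ(𝔪)` by Krull's height theorem. -/
def codim (A : Type u) [CommRing A] [IsLocalRing A] : ℕ :=
  (IsLocalRing.maximalIdeal A).spanFinrank - ((ringKrullDim A).unbotD 0).toNat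

end CUlrich

end

namespace CUlrich

open IsLocalRing TensorProduct Abelian
open scoped Pointwise

/-! Let v be the codimension. If k is infinite, superficial elements give a maximal M-regular
sequence x such that L = M/xM has length e(M) (`exists_isRegular_tendsto_hilbertSamuel`). They can
be chosen as part of a generating set of 𝔪 modulo Ann M, leaving only v further generators z. Since
μ(L) = μ(M), the hypothesis says ℓ(L) < (1 + 1/v) μ(L), that is, v·ℓ(𝔪L) < μ(L). Multiplication by
the z's is a map L → (𝔪L)^v whose kernel is the socle of L; if the socle lay inside 𝔪L, counting
lengths would give μ(L) ≤ v·ℓ(𝔪L). So some minimal generator of L is killed by 𝔪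
(`exists_socle_notMem_smul_top`), and it spans a copy of k that splits off.

For (ii), the vanishing descends to Extⁿ(N, M/xM), hence to its summand Extⁿ(N, k), and this forces
pd N < n. The residue field is made infinite by passing to S = R[X] localized at 𝔪R[X], but N is not
base-changed: S ⊗ M is viewed as an R-module, flatness gives Ext_R(N, S ⊗ M) = 0 in the same
degrees, and the socle generator found over S splits off the residue field of R over R. The
codimension is not recomputed over S either: the argument uses only an ideal J inside the
annihilator and the number of generators of the maximal ideal modulo J, which is why J is carried
along as a parameter. -/

lemma exists_forall_notMem_of_infinite_residueField {R : Type*} [CommRing R] [IsLocalRing R]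
    [Infinite (ResidueField R)] {L : Type*} [AddCommGroup L] [Module R L] [Module.Finite R L]
    (s : Set (Submodule R L)) (hs : s.Finite) (h : ∀ V ∈ s, V ≠ ⊤) :
    ∃ x : L, ∀ V ∈ s, x ∉ V := by
  by_contra! hcon
  have hcov : ⋃ i ∈ hs.toFinset, ((id i : Submodule R L) : Set L) = Set.univ := by
    ext x
    obtain ⟨V, hV, hx⟩ := hcon x
    simp only [Set.mem_iUnion, Set.mem_univ, iff_true]
    exact ⟨V, hs.mem_toFinset.mpr hV, hx⟩
  -- Neumann's lemma: some member of a finite cover has finite index. A maximal submodule above it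
  -- then has quotient k, which would be finite.
  obtain ⟨V, hV, hfi⟩ := Submodule.exists_finiteIndex_of_cover hcov
  simp only [id] at hfi
  obtain ⟨W, hW, hVW⟩ := (eq_top_or_exists_le_coatom V).resolve_left (h V (hs.mem_toFinset.mp hV))
  have hfin : Finite (L ⧸ V) := AddSubgroup.finite_quotient_of_finiteIndex
  have hfinW : Finite (L ⧸ W) :=
    Finite.of_surjective _ (Submodule.factor_surjective hVW)
  have hsimp : IsSimpleModule R (L ⧸ W) := isSimpleModule_iff_isCoatom.mpr hW
  obtain ⟨I, hI, ⟨e⟩⟩ := isSimpleModule_iff_quot_maximal.mp hsimp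
  obtain rfl := IsLocalRing.eq_maximalIdeal hI
  have : Finite (ResidueField R) := Finite.of_equiv _ e.toEquiv
  exact not_finite (ResidueField R)

/-! ### Superficial elements via the associated graded module -/

section Superficial

variable {R : Type u} [CommRing R] (I : Ideal R) (M : Type u) [AddCommGroup M] [Module R M]

/-- The `I`-filtration of all `y ∈ Iⁿ M` with `x y ∈ Iⁿ⁺² M`. -/
def colonFiltration (x : R) : I.Filtration M where
  N n := (I ^ n • ⊤ : Submodule R M) ⊓ (I ^ (n + 2) • ⊤ : Submodule R M).comap (LinearMap.lsmul R M x)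
  mono n := by
    refine inf_le_inf (Submodule.smul_mono_left (Ideal.pow_le_pow_right (by lia)))
      (Submodule.comap_mono (Submodule.smul_mono_left (Ideal.pow_le_pow_right (by lia))))
  smul_le n := by
    rw [Submodule.smul_le]
    rintro r hr y ⟨hy1, hy2⟩
    refine ⟨?_, ?_⟩
    · rw [pow_succ', mul_smul]
      exact Submodule.smul_mem_smul hr hy1
    · have : I ^ (n + 1 + 2) • (⊤ : Submodule R M) = I • I ^ (n + 2) • ⊤ := by
        rw [← mul_smul, ← pow_succ']
      simp only [SetLike.mem_coe, Submodule.mem_comap, map_smul, this]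
      exact Submodule.smul_mem_smul hr hy2

/-- The filtration `n ↦ Iⁿ⁺¹ M`. -/
def shiftFiltration : I.Filtration M where
  N n := I ^ (n + 1) • ⊤
  mono n := Submodule.smul_mono_left (Ideal.pow_le_pow_right (by lia))
  smul_le n := by rw [← mul_smul, ← pow_succ']

/-- The element `x t` of the Rees algebra. -/
noncomputable def reesLinear : I →ₗ[R] reesAlgebra I where
  toFun x := ⟨Polynomial.monomial 1 (x : R), reesAlgebra.monomial_mem.mpr (by simp)⟩
  map_add' x y := by ext1; simp
  map_smul' r x := by ext1; simp [Polynomial.smul_monomial]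

variable {I M}

lemma reesMonomial_mem_pow {j : ℕ} {a : R} (ha : a ∈ I ^ j) :
    (⟨Polynomial.monomial j a, reesAlgebra.monomial_mem.mpr ha⟩ : reesAlgebra I) ∈
      Ideal.span (Set.range (reesLinear I)) ^ j := by
  induction j generalizing a with
  | zero => simp
  | succ j ih =>
    rw [pow_succ'] at ha
    refine Submodule.smul_induction_on' (p := fun a ha =>
      (⟨Polynomial.monomial (j + 1) a, reesAlgebra.monomial_mem.mpr
        (by rw [pow_succ']; exact ha)⟩ : reesAlgebra I) ∈
      Ideal.span (Set.range (reesLinear I)) ^ (j + 1)) ha ?_ ?_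
    · intro r hr b hb
      rw [pow_succ']
      have h1 : reesLinear I ⟨r, hr⟩ ∈ Ideal.span (Set.range (reesLinear I)) :=
        Ideal.subset_span ⟨_, rfl⟩
      convert Ideal.mul_mem_mul h1 (ih hb) using 1
      ext1
      simp [reesLinear, Polynomial.monomial_mul_monomial, add_comm]
    · intro b hb c hc h1 h2
      convert Ideal.add_mem _ h1 h2 using 1
      ext1
      simp

variable [IsNoetherianRing R] [Module.Finite R M]

variable (I M) in
/-- Elements of `I` outside finitely many proper submodules are superficial up to powers of `I`. -/
lemma exists_finite_pow_smul_colonFiltration_le :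
    ∃ S : Set (Submodule R I), S.Finite ∧ (∀ V ∈ S, V ≠ ⊤) ∧
      ∀ x : I, (∀ V ∈ S, x ∉ V) → ∃ j, ∀ n,
        I ^ j • (colonFiltration I M (x : R)).N n ≤ I ^ (n + j + 1) • ⊤ := by
  classical
  let A := reesAlgebra I
  let π := (shiftFiltration I M).submodule.mkQ
  -- G is the associated graded module ⊕ IⁿM/Iⁿ⁺¹M, finitely generated over the Rees algebra.
  let G := (I.stableFiltration (⊤ : Submodule R M)).submodule.map π
  have hst := I.stableFiltration_stable (⊤ : Submodule R M)
  have hGfg : G.FG := Submodule.FG.map _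
    ((Ideal.Filtration.submodule_fg_iff_stable _ (fun i => IsNoetherian.noetherian _)).mpr hst)
  have hGfin : Module.Finite A G := Module.Finite.iff_fg.mpr hGfg
  have hGn : IsNoetherian A G := inferInstance
  -- Associated primes of G containing all of It cannot be avoided, so they are left out; they only
  -- cost a power of I.
  refine ⟨{V | ∃ P ∈ associatedPrimes A G, V = (P.restrictScalars R).comap (reesLinear I) ∧ V ≠ ⊤},
    ?_, ?_, ?_⟩
  · refine ((associatedPrimes.finite A G).image
      (fun P => (P.restrictScalars R).comap (reesLinear I))).subset ?_
    rintro V ⟨P, hP, rfl, -⟩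
    exact ⟨P, hP, rfl⟩
  · rintro V ⟨P, hP, -, h⟩
    exact h
  intro x hx
  let K := colonFiltration I M (x : R)
  let N := K.submodule.map π
  have hNG : N ≤ G := by
    refine Submodule.map_mono fun f hf i => ?_
    exact (hf i).1
  have hNfin : Module.Finite A N :=
    Module.Finite.of_injective (Submodule.inclusion hNG) (Submodule.inclusion_injective hNG)
  have hxN : reesLinear I x ∈ Module.annihilator A N := by
    rw [Module.mem_annihilator]
    rintro ⟨-, f, hf, rfl⟩
    ext1
    change reesLinear I x • π f = 0
    rw [← map_smul]
    refine (Submodule.Quotient.mk_eq_zero _).mpr fun i => ?_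
    have : (reesLinear I x • f).coeff i =
      ((Polynomial.monomial 1 (x : R)) • f).coeff i := rfl
    rw [this, PolynomialModule.monomial_smul_apply]
    split_ifs with h
    · obtain ⟨i, rfl⟩ := Nat.exists_eq_add_of_le' h
      exact (hf i).2
    · exact Submodule.zero_mem _
  let J := Ideal.span (Set.range (reesLinear I))
  -- N consists of classes in G killed by xt. A minimal prime over Ann N is associated to G and
  -- contains xt, so by the choice of x it contains all of It. Hence a power of (It) kills N.
  have hJ : J ≤ (Module.annihilator A N).radical := by
    rw [← Ideal.sInf_minimalPrimes]
    refine le_sInf fun P hP => ?_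
    have hPN : P ∈ associatedPrimes A N :=
      Module.associatedPrimes.minimalPrimes_annihilator_subset_associatedPrimes A N hP
    have hPG : P ∈ associatedPrimes A G :=
      associatedPrimes.subset_of_injective (Submodule.inclusion_injective hNG) hPN
    have hxP : reesLinear I x ∈ P := IsAssociatedPrime.annihilator_le hPN
      (Submodule.annihilator_top (R := A) (M := N) ▸ hxN)
    by_cases htop : (P.restrictScalars R).comap (reesLinear I) = ⊤
    · rw [Ideal.span_le]
      rintro - ⟨y, rfl⟩
      have : y ∈ (P.restrictScalars R).comap (reesLinear I) := htop ▸ Submodule.mem_top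
      exact this
    · exact absurd hxP (hx _ ⟨P, hPG, rfl, htop⟩)
  obtain ⟨j, hj⟩ := Ideal.exists_pow_le_of_le_radical_of_fg hJ (IsNoetherian.noetherian J)
  refine ⟨j, fun n => ?_⟩
  rw [Submodule.smul_le]
  intro a ha y hy
  have h1 := hj (reesMonomial_mem_pow ha)
  have hyN : π (PolynomialModule.single R n y) ∈ N := by
    refine ⟨_, fun i => ?_, rfl⟩
    rw [PolynomialModule.coeff_single, Finsupp.single_apply]
    split_ifs with h
    · exact h ▸ hy
    · exact Submodule.zero_mem _
  have h2 := congrArg Subtype.val (Module.mem_annihilator.mp h1 ⟨_, hyN⟩)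
  change _ • π _ = 0 at h2
  rw [← map_smul] at h2
  have h3 := (Submodule.Quotient.mk_eq_zero _).mp h2 (j + n)
  have h4 : (Polynomial.monomial j a • PolynomialModule.single R n y) =
    PolynomialModule.single R (j + n) (a • y) := PolynomialModule.monomial_smul_single ..
  rw [Subalgebra.smul_def] at h3
  simp only [h4, PolynomialModule.coeff_single, Finsupp.single_eq_same] at h3
  rwa [add_comm j n] at h3

/-- By Artin–Rees the colon filtration is stable: far out, each further term is I times the previous
one, so the factor I^j in the hypothesis is absorbed. -/
lemma exists_colonFiltration_le {x : R} {j : ℕ}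
    (hj : ∀ n, I ^ j • (colonFiltration I M x).N n ≤ I ^ (n + j + 1) • ⊤) :
    ∃ c, ∀ n ≥ c, (colonFiltration I M x).N n ≤ I ^ (n + 1) • ⊤ := by
  have hst : (colonFiltration I M x).Stable :=
    (I.stableFiltration_stable (⊤ : Submodule R M)).of_le (fun n => inf_le_left)
  obtain ⟨n₀, h₀⟩ := hst.exists_pow_smul_eq
  refine ⟨n₀ + j, fun n hn => ?_⟩
  obtain ⟨k, rfl⟩ := Nat.exists_eq_add_of_le hn
  rw [add_assoc, h₀, add_comm j k, pow_add, mul_smul]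
  refine (Submodule.smul_mono le_rfl (hj n₀)).trans ?_
  rw [← mul_smul, ← pow_add]
  exact Submodule.smul_mono_left (Ideal.pow_le_pow_right (by lia))

/-- Artin–Rees for xM, together with regularity of x, first puts y in I^c M. From there y climbs one
power of I at a time, since it lies in the colon filtration at every level below n. -/
lemma exists_forall_smul_mem_pow_smul_top {x : R} (hx : IsSMulRegular M x) {j : ℕ}
    (hj : ∀ n, I ^ j • (colonFiltration I M x).N n ≤ I ^ (n + j + 1) • ⊤) :
    ∃ c, ∀ n ≥ c, ∀ y : M, x • y ∈ (I ^ (n + 1) • ⊤ : Submodule R M) →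
      y ∈ (I ^ n • ⊤ : Submodule R M) := by
  obtain ⟨c, hc⟩ := exists_colonFiltration_le hj
  obtain ⟨k, hk⟩ := I.exists_pow_inf_eq_pow_smul (LinearMap.range (LinearMap.lsmul R M x))
  refine ⟨c + k, fun n hn y hy => ?_⟩
  have h1 : ∀ p, c ≤ p → p ≤ n → y ∈ (I ^ p • ⊤ : Submodule R M) := by
    intro p hp
    induction p, hp using Nat.le_induction with
    | base =>
      intro _
      have h2 : x • y ∈ I ^ (n + 1 - k) • LinearMap.range (LinearMap.lsmul R M x) :=
        Submodule.smul_mono le_rfl inf_le_right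
          ((hk (n + 1) (by lia)).le (Submodule.mem_inf.mpr ⟨hy, y, rfl⟩))
      rw [← Submodule.map_top, ← Submodule.map_smul''] at h2
      obtain ⟨z, hz, hzy⟩ := h2
      obtain rfl : z = y := hx hzy
      exact Submodule.smul_mono_left (Ideal.pow_le_pow_right (by lia)) hz
    | succ p hp ih =>
      intro hpn
      refine hc p hp ⟨ih (by lia), ?_⟩
      exact Submodule.smul_mono_left (Ideal.pow_le_pow_right (by lia)) hy
  exact h1 n (by lia) le_rfl

end Superficial

/-! ### Choosing a superficial element; the Hilbert–Samuel function modulo it -/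

section Local

variable {R : Type u} [CommRing R] [IsNoetherianRing R] [IsLocalRing R]
  {M : Type u} [AddCommGroup M] [Module R M] [Module.Finite R M]

/-- Three finite families of proper submodules of 𝔪 are avoided at once: those obstructing
superficiality, the traces of the associated primes of M, and 𝔪² + J. The given regular w serves to
show that the last two are proper. -/
lemma exists_superficial [Infinite (ResidueField R)] [Nontrivial M] {J : Ideal R}
    (hJ : J ≤ Module.annihilator R M)
    {w : R} (hw : w ∈ maximalIdeal R) (hwM : IsSMulRegular M w) :
    ∃ x ∈ maximalIdeal R, IsSMulRegular M x ∧ x ∉ maximalIdeal R ^ 2 ⊔ J ∧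
      ∃ c, ∀ n ≥ c, ∀ y : M, x • y ∈ (maximalIdeal R ^ (n + 1) • ⊤ : Submodule R M) →
        y ∈ (maximalIdeal R ^ n • ⊤ : Submodule R M) := by
  set m := maximalIdeal R
  obtain ⟨S, hS, hS1, hS2⟩ := exists_finite_pow_smul_colonFiltration_le m M
  have key : ∀ p : Ideal R, Submodule.comap m.subtype p = ⊤ → m ≤ p := by
    intro p hp r hr
    have : (⟨r, hr⟩ : m) ∈ Submodule.comap m.subtype p := hp ▸ Submodule.mem_top
    exact this
  obtain ⟨x, hx⟩ := exists_forall_notMem_of_infinite_residueField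
    (S ∪ (Submodule.comap m.subtype '' (associatedPrimes R M)) ∪
      {Submodule.comap m.subtype (m ^ 2 ⊔ J)})
    ((hS.union ((associatedPrimes.finite R M).image _)).union (Set.finite_singleton _)) (by
      rintro V ((hV | ⟨p, hp, rfl⟩) | rfl)
      · exact hS1 V hV
      · intro htop
        have h1 := key p htop hw
        have h2 : w ∈ ⋃ p ∈ associatedPrimes R M, (p : Set R) := Set.mem_biUnion hp h1
        rw [biUnion_associatedPrimes_eq_compl_regular] at h2
        exact h2 hwM
      · intro htop
        have h1 := key _ htop
        -- Nakayama: 𝔪 ⊆ 𝔪² + J would give 𝔪 ⊆ J, and then w would kill M.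
        have h2 : m ≤ J := by
          refine Submodule.le_of_le_smul_of_le_jacobson_bot (I := m) (IsNoetherian.noetherian m)
            (jacobson_eq_maximalIdeal ⊥ bot_ne_top).ge ?_
          rwa [sup_comm, pow_two] at h1
        have h3 : ∀ y : M, w • y = 0 := fun y => Module.mem_annihilator.mp (hJ (h2 hw)) y
        obtain ⟨y, hy⟩ := exists_ne (0 : M)
        exact hy (hwM (by simp [h3])))
  have hreg : IsSMulRegular M (x : R) := by
    by_contra hreg
    have h2 : (x : R) ∈ ⋃ p ∈ associatedPrimes R M, (p : Set R) := by
      rw [biUnion_associatedPrimes_eq_compl_regular]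
      exact hreg
    simp only [Set.mem_iUnion] at h2
    obtain ⟨p, hp, hxp⟩ := h2
    exact hx _ (Or.inl (Or.inr ⟨p, hp, rfl⟩)) hxp
  obtain ⟨j, hj⟩ := hS2 x (fun V hV => hx V (Or.inl (Or.inl hV)))
  exact ⟨x, x.2, hreg, fun h => hx _ (Or.inr rfl) h, exists_forall_smul_mem_pow_smul_top hreg hj⟩

variable (R M) in
/-- The Hilbert-Samuel function `n ↦ ℓ(M / 𝔪ⁿ M)`. -/
noncomputable def hilbertSamuel (n : ℕ) : ℕ :=
  (Module.length R (M ⧸ (maximalIdeal R ^ n • ⊤ : Submodule R M))).toNat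

omit [IsNoetherianRing R] [IsLocalRing R] [Module.Finite R M] in
variable (M) in
lemma smul_quotient_smul_top_eq_bot (I : Ideal R) :
    (I • ⊤ : Submodule R (M ⧸ (I • ⊤ : Submodule R M))) = ⊥ := by
  rw [eq_bot_iff, Submodule.smul_le]
  intro r hr z _
  obtain ⟨z, rfl⟩ := Submodule.Quotient.mk_surjective _ z
  rw [← Submodule.Quotient.mk_smul]
  exact (Submodule.Quotient.mk_eq_zero _).mpr (Submodule.smul_mem_smul hr trivial)

omit [IsNoetherianRing R] in
lemma length_ne_top_of_maximalIdeal_smul_eq_bot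
    (h : (maximalIdeal R • ⊤ : Submodule R M) = ⊥) : Module.length R M ≠ ⊤ := by
  have hker : Module.IsTorsionBySet R M (maximalIdeal R : Set R) := by
    intro y r
    rw [← Submodule.mem_bot R, ← h]
    exact Submodule.smul_mem_smul r.2 trivial
  let _ : Module (ResidueField R) M := hker.module
  have : IsScalarTower R (ResidueField R) M := hker.isScalarTower
  have : Module.Finite (ResidueField R) M := Module.Finite.of_restrictScalars_finite R _ _
  rw [Module.length_eq_of_surjective (R := ResidueField R) (residue_surjective (R := R)),
    Module.length_ne_top_iff, isFiniteLength_iff_isNoetherian_isArtinian]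
  exact ⟨inferInstance, inferInstance⟩

lemma length_ne_top_of_pow_smul_eq_bot {n : ℕ}
    (h : (maximalIdeal R ^ n • ⊤ : Submodule R M) = ⊥) : Module.length R M ≠ ⊤ := by
  induction n generalizing M with
  | zero =>
    have : Subsingleton M := by
      rw [← Submodule.subsingleton_iff R]
      exact subsingleton_of_bot_eq_top (by simpa using h.symm)
    simp
  | succ n ih =>
    have key := Module.length_eq_add_of_exact (maximalIdeal R • ⊤ : Submodule R M).subtype
      (maximalIdeal R • ⊤ : Submodule R M).mkQ (Submodule.subtype_injective _)
      (Submodule.mkQ_surjective _) (LinearMap.exact_subtype_mkQ _)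
    rw [key, ne_eq, ENat.add_eq_top, not_or]
    refine ⟨ih ?_, length_ne_top_of_maximalIdeal_smul_eq_bot ?_⟩
    · refine (Submodule.map_injective_of_injective (Submodule.subtype_injective
        (maximalIdeal R • ⊤ : Submodule R M))) ?_
      rw [Submodule.map_smul'', Submodule.map_subtype_top, Submodule.map_bot, ← mul_smul,
        ← pow_succ, h]
    · exact smul_quotient_smul_top_eq_bot M _

variable (M) in
lemma length_quotient_pow_ne_top (n : ℕ) :
    Module.length R (M ⧸ (maximalIdeal R ^ n • ⊤ : Submodule R M)) ≠ ⊤ :=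
  length_ne_top_of_pow_smul_eq_bot (smul_quotient_smul_top_eq_bot M _)

/-- Additivity of length on 0 → M/𝔪ⁿM → M/𝔪ⁿ⁺¹M → (M/xM)/𝔪ⁿ⁺¹(M/xM) → 0, the first map being
multiplication by x; `hn` is exactly its injectivity. -/
lemma hilbertSamuel_succ {x : R} (hx : x ∈ maximalIdeal R) {n : ℕ}
    (hn : ∀ y : M, x • y ∈ (maximalIdeal R ^ (n + 1) • ⊤ : Submodule R M) →
        y ∈ (maximalIdeal R ^ n • ⊤ : Submodule R M)) :
    hilbertSamuel R M (n + 1) =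
      hilbertSamuel R M n + hilbertSamuel R (QuotSMulTop x M) (n + 1) := by
  set m := maximalIdeal R
  have hle : (m ^ n • ⊤ : Submodule R M) ≤
      (m ^ (n + 1) • ⊤ : Submodule R M).comap (LinearMap.lsmul R M x) := by
    rw [← Submodule.map_le_iff_le_comap, Submodule.map_smul'', Submodule.smul_le]
    rintro r hr - ⟨y, -, rfl⟩
    change r • x • y ∈ _
    rw [← mul_smul, pow_succ]
    exact Submodule.smul_mem_smul (Ideal.mul_mem_mul hr hx) trivial
  let f := Submodule.mapQ _ _ (LinearMap.lsmul R M x) hle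
  have hle2 : (m ^ (n + 1) • ⊤ : Submodule R M) ≤
      (m ^ (n + 1) • ⊤ : Submodule R (QuotSMulTop x M)).comap (Submodule.mkQ _) :=
    Submodule.smul_top_le_comap_smul_top _ _
  let g : (M ⧸ (m ^ (n + 1) • ⊤ : Submodule R M)) →ₗ[R]
      QuotSMulTop x M ⧸ (m ^ (n + 1) • ⊤ : Submodule R (QuotSMulTop x M)) :=
    Submodule.mapQ _ _ (Submodule.mkQ _) hle2
  have hf : Function.Injective f := by
    rw [← LinearMap.ker_eq_bot, LinearMap.ker_eq_bot']
    intro y hy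
    obtain ⟨y, rfl⟩ := Submodule.Quotient.mk_surjective _ y
    rw [Submodule.mapQ_apply, Submodule.Quotient.mk_eq_zero] at hy
    exact (Submodule.Quotient.mk_eq_zero _).mpr (hn y hy)
  have hg : Function.Surjective g := by
    intro z
    obtain ⟨z, rfl⟩ := Submodule.Quotient.mk_surjective _ z
    obtain ⟨z, rfl⟩ := Submodule.Quotient.mk_surjective _ z
    exact ⟨Submodule.Quotient.mk z, rfl⟩
  have hfg : Function.Exact f g := by
    intro z
    obtain ⟨z, rfl⟩ := Submodule.Quotient.mk_surjective _ z
    constructor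
    · intro hz
      have h1 := (Submodule.Quotient.mk_eq_zero _).mp hz
      have h2 : z ∈ (m ^ (n + 1) • ⊤ : Submodule R (QuotSMulTop x M)).comap (Submodule.mkQ _) := h1
      rw [Submodule.comap_smul_top_of_surjective _ _ (Submodule.mkQ_surjective _),
        Submodule.ker_mkQ] at h2
      obtain ⟨a, ha, b, hb, rfl⟩ := Submodule.mem_sup.mp h2
      obtain ⟨b, -, rfl⟩ := (Submodule.mem_smul_pointwise_iff_exists _ _ _).mp hb
      refine ⟨Submodule.Quotient.mk b, ?_⟩
      simp only [f, Submodule.mapQ_apply, LinearMap.lsmul_apply]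
      rw [Submodule.Quotient.eq]
      simpa using ha
    · rintro ⟨b, hb⟩
      obtain ⟨b, rfl⟩ := Submodule.Quotient.mk_surjective _ b
      rw [← hb]
      change Submodule.Quotient.mk (Submodule.Quotient.mk (x • b)) = 0
      rw [(Submodule.Quotient.mk_eq_zero (x • (⊤ : Submodule R M))).mpr
        (Submodule.smul_mem_pointwise_smul _ _ _ trivial)]
      rfl
  have := Module.length_eq_add_of_exact f g hf hg hfg
  rw [hilbertSamuel, hilbertSamuel, hilbertSamuel, this,
    ENat.toNat_add (length_quotient_pow_ne_top M n) (length_quotient_pow_ne_top _ (n + 1))]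

variable (R M) in
lemma exists_pow_smul_eq_bot_of_supportDim_eq_zero (h : Module.supportDim R M = 0) :
    ∃ n, (maximalIdeal R ^ n • ⊤ : Submodule R M) = ⊥ := by
  have h1 := support_of_supportDim_eq_zero R M h
  rw [Module.support_eq_zeroLocus, PrimeSpectrum.zeroLocus_eq_iff] at h1
  have h2 : maximalIdeal R ≤ (Module.annihilator R M).radical := h1 ▸ Ideal.le_radical
  obtain ⟨n, hn⟩ := Ideal.exists_pow_le_of_le_radical_of_fg h2 (IsNoetherian.noetherian _)
  refine ⟨n, ?_⟩
  rw [eq_bot_iff, Submodule.smul_le]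
  intro r hr y _
  exact Module.mem_annihilator.mp (hn hr) y

omit [IsNoetherianRing R] in
lemma supportDim_eq_zero_of_pow_smul_eq_bot [Nontrivial M] {n : ℕ}
    (h : (maximalIdeal R ^ n • ⊤ : Submodule R M) = ⊥) : Module.supportDim R M = 0 := by
  have hsub : Subsingleton (Module.support R M) := by
    constructor
    rintro ⟨p, hp⟩ ⟨q, hq⟩
    have key : ∀ p ∈ Module.support R M, p.asIdeal = maximalIdeal R := by
      intro p hp
      rw [Module.support_eq_zeroLocus, PrimeSpectrum.mem_zeroLocus] at hp
      refine (le_maximalIdeal p.2.ne_top).antisymm (Ideal.IsPrime.le_of_pow_le (n := n) ?_)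
      refine le_trans (fun r hr => ?_) hp
      rw [Module.mem_annihilator]
      intro y
      rw [← Submodule.mem_bot R, ← h]
      exact Submodule.smul_mem_smul hr trivial
    ext1
    exact PrimeSpectrum.ext ((key p hp).trans (key q hq).symm)
  have : Nonempty (Module.support R M) := Module.nonempty_support_iff.mpr ‹_› |>.to_subtype
  exact Order.krullDim_eq_zero

end Local

/-! ### From growth of differences to growth of the sequence -/

section Growth

open Asymptotics

/-- A form of the Stolz–Cesàro theorem: if `a (n + 1) - a n = o (n ^ p)` eventually, then
`a n = o (n ^ (p + 1))`. -/
lemma isLittleO_pow_succ_of_sub {a : ℕ → ℝ} {p : ℕ}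
    (h : (fun n => a (n + 1) - a n) =o[atTop] fun n : ℕ => (n : ℝ) ^ p) :
    a =o[atTop] fun n : ℕ => (n : ℝ) ^ (p + 1) := by
  have hpos : ∀ n : ℕ, (0 : ℝ) ≤ ((n : ℝ) + 1) ^ (p + 1) - (n : ℝ) ^ (p + 1) := fun n =>
    sub_nonneg.mpr (pow_le_pow_left₀ (by positivity) (by linarith) _)
  have hle : ∀ n : ℕ, (n : ℝ) ^ p ≤ ((n : ℝ) + 1) ^ (p + 1) - (n : ℝ) ^ (p + 1) := by
    intro n
    have : (n : ℝ) ^ p ≤ ((n : ℝ) + 1) ^ p := pow_le_pow_left₀ (by positivity) (by linarith) _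
    rw [pow_succ, pow_succ]
    nlinarith [mul_le_mul_of_nonneg_right this (by positivity : (0 : ℝ) ≤ (n : ℝ) + 1)]
  have hsum : ∀ n : ℕ, ∑ i ∈ Finset.range n, (((i : ℝ) + 1) ^ (p + 1) - (i : ℝ) ^ (p + 1)) =
      (n : ℝ) ^ (p + 1) := by
    intro n
    have := Finset.sum_range_sub (fun i : ℕ => (i : ℝ) ^ (p + 1)) n
    simpa using this
  have htend : Tendsto (fun n : ℕ => (n : ℝ) ^ (p + 1)) atTop atTop :=
    (tendsto_pow_atTop (by simp)).comp tendsto_natCast_atTop_atTop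
  have h1 : (fun n => a (n + 1) - a n) =o[atTop]
      fun n : ℕ => ((n : ℝ) + 1) ^ (p + 1) - (n : ℝ) ^ (p + 1) := by
    refine h.trans_isBigO (IsBigO.of_bound 1 (Eventually.of_forall fun n => ?_))
    rw [one_mul, Real.norm_of_nonneg (by positivity), Real.norm_of_nonneg (hpos n)]
    exact hle n
  have h2 := h1.sum_range hpos (by simpa [hsum] using htend)
  simp only [hsum, Finset.sum_range_sub] at h2
  have h3 : (fun _ : ℕ => a 0) =o[atTop] fun n : ℕ => (n : ℝ) ^ (p + 1) :=
    isLittleO_const_left.mpr (Or.inr (tendsto_norm_atTop_atTop.comp htend))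
  simpa using h2.add h3

/-- If the differences of `a` grow like `L n ^ p / p!`, then `a` grows like
`L n ^ (p + 1) / (p + 1)!`. -/
lemma tendsto_div_pow_succ {a : ℕ → ℝ} {b : ℕ → ℝ} {p : ℕ} {L : ℝ}
    (hb : Tendsto (fun n : ℕ => b n / (n : ℝ) ^ p) atTop (𝓝 (L / (Nat.factorial p : ℝ))))
    (hab : ∀ᶠ n in atTop, a (n + 1) = a n + b (n + 1)) :
    Tendsto (fun n : ℕ => a n / (n : ℝ) ^ (p + 1)) atTop
      (𝓝 (L / (Nat.factorial (p + 1) : ℝ))) := by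
  set C := L / (Nat.factorial p : ℝ) with hC
  have hC' : L / (Nat.factorial (p + 1) : ℝ) = C / (p + 1) := by
    rw [hC, Nat.factorial_succ]; push_cast; rw [div_div, mul_comm]
  rw [hC']
  have hpow : Tendsto (fun n : ℕ => (((n + 1 : ℕ) : ℝ) ^ p / (n : ℝ) ^ p)) atTop (𝓝 1) := by
    have h0 : Tendsto (fun n : ℕ => (1 + 1 / (n : ℝ)) ^ p) atTop (𝓝 ((1 + 0) ^ p)) :=
      (tendsto_const_nhds.add tendsto_one_div_atTop_nhds_zero_nat).pow p
    simp only [add_zero, one_pow] at h0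
    refine h0.congr' ?_
    filter_upwards [eventually_gt_atTop 0] with n hn
    have : (n : ℝ) ≠ 0 := by positivity
    rw [← div_pow]; congr 1; push_cast; field_simp
  -- the differences of `n ^ (p + 1)` are asymptotic to `(p + 1) n ^ p`
  have hdiff : Tendsto (fun n : ℕ => (((n : ℝ) + 1) ^ (p + 1) - (n : ℝ) ^ (p + 1)) / (n : ℝ) ^ p)
      atTop (𝓝 (p + 1)) := by
    -- The ratio in question is the difference quotient of x^(p+1) at 1 with step 1/n.
    have hder : HasDerivAt (fun x : ℝ => x ^ (p + 1)) (((p + 1 : ℕ) : ℝ) * 1 ^ p) 1 :=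
      hasDerivAt_pow (p + 1) 1
    have h1 := hder.tendsto_slope_zero_right
    have h2 : Tendsto (fun n : ℕ => ((n : ℝ))⁻¹) atTop (𝓝[>] 0) :=
      tendsto_inv_atTop_nhdsGT_zero.comp tendsto_natCast_atTop_atTop
    have h3 := h1.comp h2
    simp only [one_pow, mul_one, Nat.cast_add, Nat.cast_one] at h3
    refine h3.congr' ?_
    filter_upwards [eventually_gt_atTop 0] with n hn
    have : (n : ℝ) ≠ 0 := by positivity
    have e : (1 + (n : ℝ)⁻¹) = ((n : ℝ) + 1) / n := by field_simp
    simp only [Function.comp, smul_eq_mul, inv_inv, e, div_pow]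
    field_simp
    ring
  have hlo : (fun n : ℕ => a n - C / (p + 1) * (n : ℝ) ^ (p + 1)) =o[atTop]
      fun n : ℕ => (n : ℝ) ^ (p + 1) := by
    apply isLittleO_pow_succ_of_sub
    rw [isLittleO_iff_tendsto']
    · have h1 := ((tendsto_add_atTop_iff_nat 1).mpr hb).mul hpow
      have h2 := h1.sub (hdiff.const_mul (C / (p + 1)))
      have h3 : C * 1 - C / (p + 1) * (p + 1) = 0 := by field_simp; ring
      rw [h3] at h2
      refine h2.congr' ?_
      filter_upwards [eventually_gt_atTop 0, hab] with n hn hn2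
      have : (n : ℝ) ≠ 0 := by positivity
      have : ((n + 1 : ℕ) : ℝ) ≠ 0 := by positivity
      rw [hn2]
      field_simp
      push_cast
      ring
    · filter_upwards [eventually_gt_atTop 0] with n hn h
      have : (n : ℝ) ^ p ≠ 0 := by positivity
      exact absurd h this
  have := hlo.tendsto_div_nhds_zero.add_const (C / (p + 1))
  rw [zero_add] at this
  refine this.congr' ?_
  filter_upwards [eventually_gt_atTop 0] with n hn
  have : (n : ℝ) ≠ 0 := by positivity
  field_simp
  ring

end Growth

/-! ### Regular sequences computing the multiplicity -/

section Local

variable {R : Type u} [CommRing R] [IsLocalRing R]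

/-- An element of `𝔪` outside `𝔪² + J` can replace one of the generators of `𝔪` modulo `J`. -/
lemma exists_generators_of_notMem {J : Ideal R} {s : ℕ} {y : Fin s → R}
    (hy : maximalIdeal R = J ⊔ Ideal.span (Set.range y)) {x : R} (hx : x ∈ maximalIdeal R)
    (hx2 : x ∉ maximalIdeal R ^ 2 ⊔ J) :
    ∃ s', s = s' + 1 ∧ ∃ z : Fin s' → R,
      maximalIdeal R = J ⊔ Ideal.span {x} ⊔ Ideal.span (Set.range z) := by
  obtain ⟨j, hj, b, hb, hjb⟩ := Submodule.mem_sup.mp (hy ▸ hx)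
  obtain ⟨a, rfl⟩ := (Ideal.mem_span_range_iff_exists_fun).mp hb
  have hym : ∀ i, y i ∈ maximalIdeal R := fun i => by
    rw [hy]; exact Ideal.mem_sup_right (Ideal.subset_span ⟨i, rfl⟩)
  have hJm : J ≤ maximalIdeal R := by rw [hy]; exact le_sup_left
  -- If all coefficients of x were in 𝔪, then x would lie in 𝔪² + J. The generator with a unit
  -- coefficient is the one that x replaces.
  obtain ⟨i, hi⟩ : ∃ i, IsUnit (a i) := by
    by_contra! hcon
    apply hx2
    rw [← hjb]
    refine add_mem (Ideal.mem_sup_right hj) (Ideal.mem_sup_left (sum_mem fun i _ => ?_))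
    rw [pow_two]
    exact Ideal.mul_mem_mul ((mem_maximalIdeal _).mpr (hcon i)) (hym i)
  obtain ⟨s', rfl⟩ : ∃ s', s = s' + 1 := ⟨s - 1, by have := i.2; lia⟩
  refine ⟨s', rfl, fun k => y (i.succAbove k), le_antisymm ?_ ?_⟩
  · set K := J ⊔ Ideal.span {x} ⊔ Ideal.span (Set.range fun k => y (i.succAbove k))
    have hz : ∀ k, y (i.succAbove k) ∈ K := fun k =>
      Ideal.mem_sup_right (Ideal.subset_span ⟨k, rfl⟩)
    have hxK : x ∈ K := Ideal.mem_sup_left (Ideal.mem_sup_right (Ideal.mem_span_singleton_self x))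
    have hjK : j ∈ K := Ideal.mem_sup_left (Ideal.mem_sup_left hj)
    have hyi : y i ∈ K := by
      rw [Fin.sum_univ_succAbove _ i] at hjb
      have : a i * y i ∈ K := by
        have e : a i * y i = x - j - ∑ k, a (i.succAbove k) * y (i.succAbove k) := by
          rw [← hjb]; ring
        rw [e]
        exact sub_mem (sub_mem hxK hjK) (sum_mem fun k _ => Ideal.mul_mem_left _ _ (hz k))
      exact (Ideal.unit_mul_mem_iff_mem K hi).mp this
    nth_rw 1 [hy]
    refine sup_le (le_sup_left.trans le_sup_left) (Ideal.span_le.mpr ?_)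
    rintro - ⟨k, rfl⟩
    rcases Fin.eq_self_or_eq_succAbove i k with rfl | ⟨k, rfl⟩
    · exact hyi
    · exact hz k
  · refine sup_le (sup_le hJm ?_) (Ideal.span_le.mpr ?_)
    · rwa [Ideal.span_singleton_le_iff_mem]
    · rintro - ⟨k, rfl⟩
      exact hym _

variable [IsNoetherianRing R]

omit [IsNoetherianRing R] in
lemma maximalIdeal_smul_top_lt_top (M : Type u) [AddCommGroup M] [Module R M] [Module.Finite R M]
    [Nontrivial M] : (maximalIdeal R • ⊤ : Submodule R M) < ⊤ :=
  lt_top_iff_ne_top.mpr fun h =>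
    Submodule.top_ne_ideal_smul_of_le_jacobson_annihilator (maximalIdeal_le_jacobson _) h.symm

/-- Depth drops by at most one modulo a regular element. -/
lemma exists_isRegular_quotSMulTop {M : Type u} [AddCommGroup M] [Module R M] [Module.Finite R M]
    [Nontrivial M] {r : ℕ}
    (h : ∃ rs : List R, rs.length = r + 1 ∧ (∀ a ∈ rs, a ∈ maximalIdeal R) ∧
      RingTheory.Sequence.IsRegular M rs)
    {x : R} (hx : x ∈ maximalIdeal R) (hreg : IsSMulRegular M x) :
    ∃ rs : List R, rs.length = r ∧ (∀ a ∈ rs, a ∈ maximalIdeal R) ∧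
      RingTheory.Sequence.IsRegular (QuotSMulTop x M) rs := by
  have : Nontrivial (QuotSMulTop x M) := nontrivial_quotSMulTop_of_mem_maximalIdeal M hx
  -- The Ext characterization of depth does not refer to a particular sequence, so x need not belong
  -- to the given one; the long exact sequence of x then loses one degree.
  have h1 := ((ModuleCat.exists_isRegular_tfae (maximalIdeal R) (r + 1) (ModuleCat.of R M)
    (maximalIdeal_smul_top_lt_top M)).out 3 1).mp h
  refine ((ModuleCat.exists_isRegular_tfae (maximalIdeal R) r (ModuleCat.of R (QuotSMulTop x M))
    (maximalIdeal_smul_top_lt_top _)).out 1 3).mp fun i hi => ?_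
  have zero1 := AddCommGrpCat.isZero_of_iff_subsingleton.mpr (h1 i (by lia))
  have zero2 := AddCommGrpCat.isZero_of_iff_subsingleton.mpr (h1 (i + 1) (by lia))
  have hreg' : IsSMulRegular (ModuleCat.of R M) x := hreg
  exact AddCommGrpCat.subsingleton_of_isZero <| ShortComplex.Exact.isZero_of_both_zeros
    ((Abelian.Ext.covariant_sequence_exact₃' _ hreg'.smulShortComplex_shortExact) i (i + 1) rfl)
    (zero1.eq_zero_of_src _) (zero2.eq_zero_of_tgt _)

/-- A Cohen-Macaulay module over a local ring with infinite residue field has a maximal regular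
sequence which is part of a system of generators of the maximal ideal and which computes the
multiplicity. -/
theorem exists_isRegular_tendsto_hilbertSamuel [Infinite (ResidueField R)] {r : ℕ}
    {M : Type u} [AddCommGroup M] [Module R M] [Module.Finite R M] [Nontrivial M]
    (hdim : Module.supportDim R M = r)
    (hdepth : ∃ rs : List R, rs.length = r ∧ (∀ a ∈ rs, a ∈ maximalIdeal R) ∧
      RingTheory.Sequence.IsRegular M rs)
    {J : Ideal R} (hJ : J ≤ Module.annihilator R M) {s : ℕ} {y : Fin s → R}
    (hy : maximalIdeal R = J ⊔ Ideal.span (Set.range y)) :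
    ∃ xs : List R, (∀ a ∈ xs, a ∈ maximalIdeal R) ∧ RingTheory.Sequence.IsRegular M xs ∧
      xs.length = r ∧
      (∃ v, s = v + r ∧ ∃ z : Fin v → R,
        maximalIdeal R = J ⊔ Ideal.ofList xs ⊔ Ideal.span (Set.range z)) ∧
      Tendsto (fun n : ℕ => (hilbertSamuel R M n : ℝ) / (n : ℝ) ^ r) atTop
        (𝓝 (((Module.length R (M ⧸ (Ideal.ofList xs • ⊤ : Submodule R M))).toNat : ℝ) /
          (Nat.factorial r : ℝ))) := by
  induction r generalizing M J s with
  | zero =>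
    refine ⟨[], by simp, RingTheory.Sequence.IsRegular.nil R M, rfl, ⟨s, rfl, y, by simpa using hy⟩, ?_⟩
    obtain ⟨n₀, hn₀⟩ := exists_pow_smul_eq_bot_of_supportDim_eq_zero R M (by simpa using hdim)
    refine tendsto_const_nhds.congr' ?_
    filter_upwards [eventually_ge_atTop n₀] with n hn
    have h1 : (maximalIdeal R ^ n • ⊤ : Submodule R M) = ⊥ := by
      rw [eq_bot_iff, ← hn₀]
      exact Submodule.smul_mono_left (Ideal.pow_le_pow_right hn)
    have h2 : (Ideal.ofList ([] : List R) • ⊤ : Submodule R M) = ⊥ := by simp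
    rw [hilbertSamuel, h1, h2]
    simp
  | succ r ih =>
    obtain ⟨ws, hlen, hws, hwreg⟩ := id hdepth
    obtain ⟨w, ws, rfl⟩ := List.exists_cons_of_length_eq_add_one hlen
    obtain ⟨x, hx, hxreg, hx2, c, hc⟩ := exists_superficial hJ (hws w (by simp))
      ((RingTheory.Sequence.isRegular_cons_iff M w ws).mp hwreg).1
    have : Nontrivial (QuotSMulTop x M) := nontrivial_quotSMulTop_of_mem_maximalIdeal M hx
    obtain ⟨s', rfl, z, hz⟩ := exists_generators_of_notMem hy hx hx2
    have hdim' : Module.supportDim R (QuotSMulTop x M) = r := by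
      have h1 := Module.supportDim_quotSMulTop_succ_eq_supportDim hxreg hx
      rw [hdim] at h1
      push_cast at h1
      exact le_antisymm (ENat.WithBot.add_le_add_one_right_iff.mp h1.le)
        (ENat.WithBot.add_le_add_one_right_iff.mp h1.ge)
    -- J absorbs x, so the induction continues on M/xM with one generator of 𝔪 fewer.
    have hJ' : J ⊔ Ideal.span {x} ≤ Module.annihilator R (QuotSMulTop x M) := by
      refine sup_le (hJ.trans ?_) ?_
      · exact LinearMap.annihilator_le_of_surjective (Submodule.mkQ _) (Submodule.mkQ_surjective _)
      · rw [Ideal.span_singleton_le_iff_mem]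
        exact QuotSMulTop.mem_annihilator M x
    obtain ⟨xs, h1, h2, h3, ⟨v, rfl, t, ht⟩, h5⟩ :=
      ih hdim' (exists_isRegular_quotSMulTop hdepth hx hxreg) hJ' hz
    refine ⟨x :: xs, by simpa using ⟨hx, h1⟩, RingTheory.Sequence.IsRegular.cons hxreg h2,
      by simp [h3], ⟨v, by ring, t, ?_⟩, ?_⟩
    · rw [Ideal.ofList_cons, ← sup_assoc, ← ht]
    · rw [(Submodule.quotOfListConsSMulTopEquivQuotSMulTopInner M x xs).length_eq]
      refine tendsto_div_pow_succ h5 ?_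
      filter_upwards [eventually_ge_atTop c] with n hn
      rw [hilbertSamuel_succ hx (hc n hn)]
      push_cast
      rfl

end Local

/-! ### Socle elements outside 𝔪L and the splitting of k -/

section Socle

variable {R : Type u} [CommRing R] [IsLocalRing R] {L : Type u} [AddCommGroup L] [Module R L]

/-- A module of finite length whose length is small compared to its number of generators has a
minimal generator killed by the maximal ideal. -/
lemma exists_socle_notMem_smul_top [Module.Finite R L] [Nontrivial L]
    (hfin : Module.length R L ≠ ⊤) {J : Ideal R}
    (hJ : J ≤ Module.annihilator R L) {v : ℕ} {z : Fin v → R}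
    (hz : maximalIdeal R = J ⊔ Ideal.span (Set.range z))
    (hv : v = 0 ∨ ((Module.length R L).toNat : ℝ) < (1 + 1 / (v : ℝ)) *
      ((Module.length R (L ⧸ (maximalIdeal R • ⊤ : Submodule R L))).toNat : ℝ)) :
    ∃ s : L, (∀ r ∈ maximalIdeal R, r • s = 0) ∧ s ∉ (maximalIdeal R • ⊤ : Submodule R L) := by
  set m := maximalIdeal R
  set mL := (m • ⊤ : Submodule R L)
  have hzm : ∀ i, z i ∈ m := fun i => by
    rw [hz]; exact Ideal.mem_sup_right (Ideal.subset_span ⟨i, rfl⟩)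
  -- Since J kills L and 𝔪 = J + (z), the kernel of f is the socle of L.
  let f : L →ₗ[R] (Fin v → mL) := LinearMap.pi fun i =>
    (LinearMap.lsmul R L (z i)).codRestrict mL fun y => Submodule.smul_mem_smul (hzm i) trivial
  have hker : ∀ s ∈ LinearMap.ker f, ∀ r ∈ m, r • s = 0 := by
    intro s hs r hr
    have h1 : m ≤ (Submodule.span R {s}).annihilator := by
      rw [hz]
      refine sup_le (fun a ha => ?_) (Ideal.span_le.mpr ?_)
      · rw [Submodule.mem_annihilator_span_singleton]
        exact Module.mem_annihilator.mp (hJ ha) s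
      · rintro - ⟨i, rfl⟩
        rw [SetLike.mem_coe, Submodule.mem_annihilator_span_singleton]
        exact congrArg Subtype.val (congrFun (LinearMap.mem_ker.mp hs) i)
    exact (Submodule.mem_annihilator_span_singleton s r).mp (h1 hr)
  by_contra! hcon
  have hle : LinearMap.ker f ≤ mL := fun s hs => hcon s (hker s hs)
  have e1 := Module.length_eq_add_of_exact mL.subtype mL.mkQ (Submodule.subtype_injective _)
    (Submodule.mkQ_surjective _) (LinearMap.exact_subtype_mkQ _)
  have e2 := Module.length_eq_add_of_exact (LinearMap.ker f).subtype f.rangeRestrict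
    (Submodule.subtype_injective _) f.surjective_rangeRestrict
    (LinearMap.exact_iff.mpr (by simp))
  have e3 : Module.length R (LinearMap.ker f) ≤ Module.length R mL :=
    Module.length_le_of_injective _ (Submodule.inclusion_injective hle)
  have e4 : Module.length R (LinearMap.range f) ≤ v * Module.length R mL := by
    refine (Module.length_le_of_injective _ (Submodule.subtype_injective _)).trans ?_
    rw [Module.length_pi_of_fintype]
    simp
  have hpos : 0 < Module.length R (L ⧸ mL) := by
    rw [Module.length_pos_iff]
    exact Submodule.Quotient.nontrivial_iff.mpr (maximalIdeal_smul_top_lt_top L).ne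
  have hL := hfin
  rw [e1, ne_eq, ENat.add_eq_top, not_or] at hL
  have hL2 := hfin
  rw [e2, ne_eq, ENat.add_eq_top, not_or] at hL2
  obtain ⟨p, hp⟩ := ENat.ne_top_iff_exists.mp hL.1
  obtain ⟨q, hq⟩ := ENat.ne_top_iff_exists.mp hL.2
  obtain ⟨k, hk⟩ := ENat.ne_top_iff_exists.mp hL2.1
  obtain ⟨i, hi⟩ := ENat.ne_top_iff_exists.mp hL2.2
  rw [← hk, ← hp] at e3
  rw [← hi, ← hp] at e4
  rw [← hq] at hpos
  have e5 : (p : ℕ∞) + q = k + i := by rw [hp, hq, hk, hi, ← e1, ← e2]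
  norm_cast at e3 e4 e5 hpos
  have hlen : (Module.length R L).toNat = p + q := by
    rw [e1, ← hp, ← hq]; norm_cast
  rw [hlen, ← hq, ENat.toNat_natCast] at hv
  -- Here p = ℓ(𝔪L) and q = μ(L). From p + q = k + i, k ≤ p and i ≤ vp one gets q ≤ vp,
  -- contradicting q > 0 when v = 0 and the length bound otherwise.
  have e6 : q ≤ v * p := by lia
  rcases hv with rfl | hv
  · lia
  · have hv0 : v ≠ 0 := by rintro rfl; lia
    have hvr : (0 : ℝ) < v := by positivity
    have e7 : (q : ℝ) ≤ v * p := by exact_mod_cast e6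
    have : ((p + q : ℕ) : ℝ) < q + q / v := by
      refine hv.trans_eq ?_
      field_simp
    push_cast at this
    have h8 : (p : ℝ) < q / v := by linarith
    rw [lt_div_iff₀ hvr] at h8
    linarith

/-- A functional on the vector space L/𝔪L that is nonzero at s gives L → k whose composite with k →
L, 1 ↦ s, is multiplication by a nonzero scalar. L need not be finitely generated, which matters
when L comes from S ⊗ M. -/
lemma isDirectSummand_residueField {s : L} (hs : ∀ r ∈ maximalIdeal R, r • s = 0)
    (hs' : s ∉ (maximalIdeal R • ⊤ : Submodule R L)) :
    IsDirectSummand R L (ResidueField R) := by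
  set mL := (maximalIdeal R • ⊤ : Submodule R L)
  have htor : Module.IsTorsionBySet R (L ⧸ mL) (maximalIdeal R : Set R) := by
    intro y r
    rw [← Submodule.mem_bot R, ← smul_quotient_smul_top_eq_bot L (maximalIdeal R)]
    exact Submodule.smul_mem_smul r.2 trivial
  let _ : Module (ResidueField R) (L ⧸ mL) := htor.module
  have : IsScalarTower R (ResidueField R) (L ⧸ mL) := htor.isScalarTower
  have hne : mL.mkQ s ≠ 0 := fun h => hs' ((Submodule.Quotient.mk_eq_zero _).mp h)
  obtain ⟨φ, hφ⟩ : ∃ φ : Module.Dual (ResidueField R) (L ⧸ mL), φ (mL.mkQ s) ≠ 0 := by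
    by_contra! h
    exact hne ((Module.forall_dual_apply_eq_zero_iff (ResidueField R) _).mp h)
  let f : L →ₗ[R] ResidueField R := (φ.restrictScalars R) ∘ₗ mL.mkQ
  let g : ResidueField R →ₗ[R] L :=
    Submodule.liftQ (maximalIdeal R) (LinearMap.toSpanSingleton R L s) fun r hr => hs r hr
  have hg : ∀ r : R, g (residue R r) = r • s := fun r => rfl
  have hfg : ∀ a : ResidueField R, f (g a) = a * f s := by
    intro a
    obtain ⟨r, rfl⟩ := residue_surjective a
    rw [hg, map_smul, Algebra.smul_def]
    rfl
  have hfs : f s ≠ 0 := hφ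
  refine ⟨LinearMap.range g, LinearMap.ker f, ⟨?_, ?_⟩, ⟨LinearEquiv.ofInjective g ?_⟩⟩
  · rw [Submodule.disjoint_def]
    rintro - ⟨a, rfl⟩ ha
    rw [LinearMap.mem_ker, hfg] at ha
    rw [(mul_eq_zero.mp ha).resolve_right hfs, map_zero]
  · rw [codisjoint_iff, eq_top_iff]
    intro y _
    refine Submodule.mem_sup.mpr ⟨g (f y * (f s)⁻¹), ⟨_, rfl⟩, y - g (f y * (f s)⁻¹), ?_, by simp⟩
    rw [LinearMap.mem_ker, map_sub, hfg]
    field_simp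
    simp
  · rw [← LinearMap.ker_eq_bot, LinearMap.ker_eq_bot']
    intro a ha
    have := hfg a
    rw [ha, map_zero] at this
    exact (mul_eq_zero.mp this.symm).resolve_right hfs

end Socle

/-! ### The socle generator of a Cohen–Macaulay module of small multiplicity -/

section Core

variable {R : Type u} [CommRing R] [IsNoetherianRing R] [IsLocalRing R]
  {M : Type u} [AddCommGroup M] [Module R M] [Module.Finite R M]

/-- A Cohen-Macaulay module of small multiplicity over a local ring with infinite residue field:
modulo some regular sequence there is a minimal generator killed by the maximal ideal. -/
theorem exists_isRegular_exists_socle [Infinite (ResidueField R)] [Nontrivial M] {r : ℕ}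
    (hdim : Module.supportDim R M = r)
    (hdepth : ∃ rs : List R, rs.length = r ∧ (∀ a ∈ rs, a ∈ maximalIdeal R) ∧
      RingTheory.Sequence.IsRegular M rs)
    {J : Ideal R} (hJ : J ≤ Module.annihilator R M) {s : ℕ} {y : Fin s → R}
    (hy : maximalIdeal R = J ⊔ Ideal.span (Set.range y)) {c : ℝ}
    (he : (Nat.factorial r : ℝ) *
      limUnder atTop (fun n : ℕ => (hilbertSamuel R M n : ℝ) / (n : ℝ) ^ r) ≤
      c * hilbertSamuel R M 1)
    (hc : s - r = 0 ∨ c < 1 + 1 / ((s - r : ℕ) : ℝ)) :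
    ∃ xs : List R, (∀ a ∈ xs, a ∈ maximalIdeal R) ∧ RingTheory.Sequence.IsRegular M xs ∧
      xs.length = r ∧ ∃ t : M ⧸ (Ideal.ofList xs • ⊤ : Submodule R M),
        (∀ a ∈ maximalIdeal R, a • t = 0) ∧
          t ∉ (maximalIdeal R • ⊤ : Submodule R (M ⧸ (Ideal.ofList xs • ⊤ : Submodule R M))) := by
  obtain ⟨xs, hxs, hreg, hlen, ⟨v, rfl, z, hz⟩, hlim⟩ :=
    exists_isRegular_tendsto_hilbertSamuel hdim hdepth hJ hy
  refine ⟨xs, hxs, hreg, hlen, ?_⟩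
  have hle : Ideal.ofList xs ≤ maximalIdeal R := by
    rw [hz]; exact le_sup_right.trans le_sup_left
  set L := M ⧸ (Ideal.ofList xs • ⊤ : Submodule R M)
  have hL : Nontrivial L := RingTheory.Sequence.IsRegular.quot_ofList_smul_nontrivial hreg ⊤
  have hJL : J ⊔ Ideal.ofList xs ≤ Module.annihilator R L := by
    refine sup_le (hJ.trans ?_) fun a ha => ?_
    · exact LinearMap.annihilator_le_of_surjective (Submodule.mkQ _) (Submodule.mkQ_surjective _)
    · rw [Module.mem_annihilator]
      intro t
      rw [← Submodule.mem_bot R, ← smul_quotient_smul_top_eq_bot M (Ideal.ofList xs)]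
      exact Submodule.smul_mem_smul ha trivial
  have hdimL : Module.supportDim R L = 0 := by
    have h1 := Module.supportDim_add_length_eq_supportDim_of_isRegular xs hreg
    rw [hdim, hlen] at h1
    replace h1 := h1.trans (zero_add _).symm
    exact le_antisymm (ENat.WithBot.add_le_add_natCast_right_iff.mp h1.le)
      (ENat.WithBot.add_le_add_natCast_right_iff.mp h1.ge)
  obtain ⟨k, hk⟩ := exists_pow_smul_eq_bot_of_supportDim_eq_zero R L hdimL
  have hμ : (Module.length R (L ⧸ (maximalIdeal R • ⊤ : Submodule R L))).toNat =
      hilbertSamuel R M 1 := by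
    have h1 : (maximalIdeal R • ⊤ : Submodule R L) =
        (maximalIdeal R • ⊤ : Submodule R M).map (Submodule.mkQ _) := by
      rw [Submodule.map_smul'', Submodule.map_top, Submodule.range_mkQ]
    rw [h1, (Submodule.quotientQuotientEquivQuotient _ _ (Submodule.smul_mono_left hle)).length_eq,
      hilbertSamuel, pow_one]
  refine exists_socle_notMem_smul_top (length_ne_top_of_pow_smul_eq_bot hk) hJL hz ?_
  -- Now s = v + r, so the truncated difference s - r is the true number v of remaining generators.
  rw [Nat.add_sub_cancel] at hc
  refine hc.imp_right fun hc => ?_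
  rw [hlim.limUnder_eq, mul_div_cancel₀ _ (by positivity)] at he
  rw [hμ]
  refine lt_of_le_of_lt he (mul_lt_mul_of_pos_right hc ?_)
  rw [← hμ, Nat.cast_pos, pos_iff_ne_zero, ne_eq, ENat.toNat_eq_zero, not_or,
    Module.length_eq_zero_iff]
  refine ⟨?_, length_ne_top_of_maximalIdeal_smul_eq_bot (smul_quotient_smul_top_eq_bot _ _)⟩
  rw [Submodule.Quotient.subsingleton_iff]
  exact (maximalIdeal_smul_top_lt_top L).ne

end Core

/-! ### Flat extension to an infinite residue field -/

section Extension

/-- Every Noetherian local ring has a flat local extension with the same maximal ideal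
(extended) and with infinite residue field, namely `R[X]` localized at `𝔪 R[X]`. -/
theorem exists_flat_extension_infinite_residueField (R : Type u) [CommRing R] [IsNoetherianRing R]
    [IsLocalRing R] :
    ∃ (S : Type u) (_ : CommRing S) (_ : Algebra R S) (_ : IsLocalRing S),
      IsNoetherianRing S ∧ Module.Flat R S ∧
      (maximalIdeal R).map (algebraMap R S) = maximalIdeal S ∧ Infinite (ResidueField S) := by
  let P : Ideal (Polynomial R) := (maximalIdeal R).map Polynomial.C
  have hP : P.IsPrime := Ideal.isPrime_map_C_of_isPrime
  let S := Localization.AtPrime P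
  refine ⟨S, inferInstance, inferInstance, inferInstance, inferInstance, ?_, ?_, ?_⟩
  · exact Module.Flat.trans R (Polynomial R) S
  · rw [IsScalarTower.algebraMap_eq R (Polynomial R) S, ← Ideal.map_map]
    exact Localization.AtPrime.map_eq_maximalIdeal
  · refine Infinite.of_injective
      (fun n : ℕ => residue S (algebraMap (Polynomial R) S (Polynomial.X ^ n))) fun i j hij => ?_
    by_contra hne
    have h1 : algebraMap (Polynomial R) S (Polynomial.X ^ i - Polynomial.X ^ j) ∈
        maximalIdeal S := by
      rw [← residue_eq_zero_iff, map_sub, map_sub]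
      exact sub_eq_zero.mpr hij
    rw [IsLocalization.AtPrime.to_map_mem_maximal_iff S P, Ideal.mem_map_C_iff] at h1
    have := h1 i
    simp only [Polynomial.coeff_sub, Polynomial.coeff_X_pow, if_neg hne] at this
    simp at this

variable {R : Type u} [CommRing R] [IsLocalRing R]
  {M : Type u} [AddCommGroup M] [Module R M]
  {S : Type u} [CommRing S] [Algebra R S] [IsLocalRing S]

lemma isLocalHom_of_map_maximalIdeal
    (h : (maximalIdeal R).map (algebraMap R S) = maximalIdeal S) :
    IsLocalHom (algebraMap R S) :=
  ((IsLocalRing.local_hom_TFAE (algebraMap R S)).out 2 0).mp h.le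

/-- Flat local base change multiplies length by ℓ(S/𝔪S), which is 1 here. -/
lemma hilbertSamuel_baseChange [Module.Flat R S]
    (h : (maximalIdeal R).map (algebraMap R S) = maximalIdeal S) (n : ℕ) :
    hilbertSamuel S (S ⊗[R] M) n = hilbertSamuel R M n := by
  have := isLocalHom_of_map_maximalIdeal h
  rw [hilbertSamuel, hilbertSamuel, ← h, ← Ideal.map_pow,
    (TensorProduct.tensorQuotMapSMulEquivTensorQuot M S (maximalIdeal R ^ n)).length_eq,
    IsLocalRing.length_baseChange, h]
  have : Module.length S (S ⧸ maximalIdeal S) = 1 := by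
    rw [Module.length_eq_one_iff, isSimpleModule_iff_isCoatom]
    exact Ideal.isMaximal_def.mp inferInstance
  rw [this, mul_one]

variable [IsNoetherianRing R] [IsNoetherianRing S] [Module.Finite R M]

/-- Cutting by the maximal regular sequence leaves a module killed by a power of 𝔪, which remains
true over S. So the quotient over S has dimension 0, and the r regular elements account for the
whole dimension. -/
lemma supportDim_baseChange_of_isRegular [Module.Flat R S]
    (h : (maximalIdeal R).map (algebraMap R S) = maximalIdeal S) {r : ℕ}
    (hdim : Module.supportDim R M = r) {rs : List R} (hlen : rs.length = r)
    (hreg : RingTheory.Sequence.IsRegular M rs) :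
    Module.supportDim S (S ⊗[R] M) = r ∧
      RingTheory.Sequence.IsRegular (S ⊗[R] M) (rs.map (algebraMap R S)) := by
  have := isLocalHom_of_map_maximalIdeal h
  have : Module.FaithfullyFlat R S := Module.FaithfullyFlat.of_flat_of_isLocalHom
  have hreg' : RingTheory.Sequence.IsRegular (S ⊗[R] M) (rs.map (algebraMap R S)) :=
    hreg.of_faithfullyFlat_of_isBaseChange (TensorProduct.isBaseChange R M S)
  refine ⟨?_, hreg'⟩
  have h1 := Module.supportDim_add_length_eq_supportDim_of_isRegular _ hreg'
  have h2 := Module.supportDim_add_length_eq_supportDim_of_isRegular _ hreg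
  rw [hdim, hlen] at h2
  replace h2 := h2.trans (zero_add _).symm
  have h3 : Module.supportDim R (M ⧸ (Ideal.ofList rs • ⊤ : Submodule R M)) = 0 :=
    le_antisymm (ENat.WithBot.add_le_add_natCast_right_iff.mp h2.le)
      (ENat.WithBot.add_le_add_natCast_right_iff.mp h2.ge)
  obtain ⟨k, hk⟩ := exists_pow_smul_eq_bot_of_supportDim_eq_zero R _ h3
  rw [← h1, List.length_map, hlen]
  have h4 : (maximalIdeal S ^ k • ⊤ : Submodule S
      ((S ⊗[R] M) ⧸ (Ideal.ofList (rs.map (algebraMap R S)) • ⊤ : Submodule S (S ⊗[R] M)))) = ⊥ := by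
    have hann : maximalIdeal S ^ k ≤
        Module.annihilator S (S ⊗[R] (M ⧸ (Ideal.ofList rs • ⊤ : Submodule R M))) := by
      rw [← h, ← Ideal.map_pow, Ideal.map_le_iff_le_comap]
      intro a ha
      rw [Ideal.mem_comap, Module.mem_annihilator]
      intro t
      rw [algebraMap_smul]
      induction t with
      | zero => simp
      | add t u ht hu => rw [smul_add, ht, hu, add_zero]
      | tmul b m =>
        have : a • m = 0 := by
          rw [← Submodule.mem_bot R, ← hk]
          exact Submodule.smul_mem_smul ha trivial
        rw [← TensorProduct.tmul_smul, this, TensorProduct.tmul_zero]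
    rw [← (TensorProduct.tensorQuotMapSMulEquivTensorQuot M S (Ideal.ofList rs)).annihilator_eq,
      Ideal.map_ofList] at hann
    rw [eq_bot_iff, Submodule.smul_le]
    intro a ha t _
    exact Module.mem_annihilator.mp (hann ha) t
  have : Nontrivial ((S ⊗[R] M) ⧸ (Ideal.ofList (rs.map (algebraMap R S)) • ⊤ :
      Submodule S (S ⊗[R] M))) := RingTheory.Sequence.IsRegular.quot_ofList_smul_nontrivial hreg' ⊤
  rw [supportDim_eq_zero_of_pow_smul_eq_bot h4, zero_add]

end Extension

/-! ### Hom into a flat base change -/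

section HomBaseChange

variable {R : Type u} [CommRing R]

/-- Every homomorphism from a finitely presented module to `S ⊗ M`, `S` flat, is a sum of
homomorphisms of the form `s ⊗ g`. -/
lemma lTensorHomToHomLTensor_surjective [IsNoetherianRing R] (N M S : Type u)
    [AddCommGroup N] [Module R N] [Module.Finite R N] [AddCommGroup M] [Module R M]
    [AddCommGroup S] [Module R S] [Module.Flat R S] :
    Function.Surjective (TensorProduct.lTensorHomToHomLTensor (.id R) N S M) := by
  obtain ⟨b, p, hp⟩ := Module.Finite.exists_fin' R N
  obtain ⟨a, q, hq⟩ := Module.Finite.exists_fin' R (LinearMap.ker p)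
  let d : (Fin a → R) →ₗ[R] (Fin b → R) := (LinearMap.ker p).subtype ∘ₗ q
  have hdp : Function.Exact d p := by
    rw [LinearMap.exact_iff, LinearMap.range_comp, LinearMap.range_eq_top.mpr hq,
      Submodule.map_subtype_top]
  intro h
  -- On the finite free modules of the presentation the canonical map is bijective, so h ∘ p lifts
  -- to t. Flatness keeps Hom(N, M) → Hom(F₀, M) → Hom(F₁, M) exact after tensoring, so t comes from
  -- S ⊗ Hom(N, M).
  let t := (lTensorHomEquivHomLTensor R (Fin b → R) S M).symm (h ∘ₗ p)
  have ht : TensorProduct.lTensorHomToHomLTensor (.id R) (Fin b → R) S M t = h ∘ₗ p := by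
    rw [← lTensorHomEquivHomLTensor_apply, LinearEquiv.apply_symm_apply]
  have nat : ∀ {A B : Type u} [AddCommGroup A] [Module R A] [AddCommGroup B] [Module R B]
      (f : A →ₗ[R] B) (t : S ⊗[R] (B →ₗ[R] M)),
      TensorProduct.lTensorHomToHomLTensor (.id R) A S M
        (LinearMap.lTensor S (LinearMap.lcomp R M f) t) =
      TensorProduct.lTensorHomToHomLTensor (.id R) B S M t ∘ₗ f := by
    intro A B _ _ _ _ f t
    induction t with
    | zero => simp
    | add t u ht hu => simp only [map_add, ht, hu, LinearMap.add_comp]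
    | tmul s g => ext; simp
  have hz : LinearMap.lTensor S (LinearMap.lcomp R M d) t = 0 := by
    apply (lTensorHomEquivHomLTensor R (Fin a → R) S M).injective
    rw [lTensorHomEquivHomLTensor_apply, nat, ht, map_zero, LinearMap.comp_assoc]
    have : p ∘ₗ d = 0 := hdp.linearMap_comp_eq_zero
    rw [this, LinearMap.comp_zero]
  obtain ⟨w, hw⟩ := (Module.Flat.lTensor_exact S
    (LinearMap.exact_lcomp_of_exact_of_surjective M hdp hp) t).mp hz
  refine ⟨w, ?_⟩
  rw [← hw, nat] at ht
  exact LinearMap.cancel_right hp |>.mp ht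

end HomBaseChange

/-! ### Vanishing of Ext: syzygies, base change, quotients, summands -/

section Ext

lemma shortExact_of_exact {R : Type u} [CommRing R] {A B C : Type u} [AddCommGroup A]
    [AddCommGroup B] [AddCommGroup C] [Module R A] [Module R B] [Module R C]
    {f : A →ₗ[R] B} {g : B →ₗ[R] C} (hf : Function.Injective f) (hfg : Function.Exact f g)
    (hg : Function.Surjective g) :
    (ShortComplex.mk (ModuleCat.ofHom f) (ModuleCat.ofHom g) (by
      rw [← ModuleCat.ofHom_comp, hfg.linearMap_comp_eq_zero]; rfl)).ShortExact where
  exact := (ShortComplex.ShortExact.moduleCat_exact_iff_function_exact _).mpr hfg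
  mono_f := (ModuleCat.mono_iff_injective _).mpr hf
  epi_g := (ModuleCat.epi_iff_surjective _).mpr hg

variable {R : Type u} [CommRing R]

lemma subsingleton_ext_zero_iff (N Y : Type u) [AddCommGroup N] [Module R N]
    [AddCommGroup Y] [Module R Y] :
    Subsingleton (Ext (ModuleCat.of R N) (ModuleCat.of R Y) 0) ↔ Subsingleton (N →ₗ[R] Y) :=
  (Ext.addEquiv₀.trans ModuleCat.homAddEquiv).subsingleton_congr

variable {N : Type u} [AddCommGroup N] [Module R N] {F : Type u} [AddCommGroup F] [Module R F]
  [Module.Free R F] {p : F →ₗ[R] N} (hp : Function.Surjective p)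
  (Y : Type u) [AddCommGroup Y] [Module R Y]

include hp

/-- Since F is projective, Ext¹(N, Y) is the cokernel of Hom(F, Y) → Hom(ker p, Y). -/
lemma subsingleton_ext_one_iff :
    Subsingleton (Ext (ModuleCat.of R N) (ModuleCat.of R Y) 1) ↔
      ∀ φ : LinearMap.ker p →ₗ[R] Y, ∃ ψ : F →ₗ[R] Y, ψ ∘ₗ (LinearMap.ker p).subtype = φ := by
  have hS := LinearMap.shortExact_shortComplexKer hp
  constructor
  · intro hsub φ
    let x : Ext p.shortComplexKer.X₁ (ModuleCat.of R Y) 0 := Ext.mk₀ (ModuleCat.ofHom φ)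
    have hx : hS.extClass.comp x (add_zero 1) = 0 := Subsingleton.elim (h := hsub) _ _
    obtain ⟨y, hy⟩ := Ext.contravariant_sequence_exact₁ hS _ x (add_zero 1) hx
    obtain ⟨ψ, rfl⟩ := (Ext.mk₀_bijective _ _).2 y
    rw [Ext.mk₀_comp_mk₀] at hy
    have := (Ext.mk₀_bijective _ _).1 hy
    exact ⟨ψ.hom, congrArg ModuleCat.Hom.hom this⟩
  · intro h
    refine ⟨fun a b => ?_⟩
    have key : ∀ x : Ext (ModuleCat.of R N) (ModuleCat.of R Y) 1, x = 0 := by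
      intro x
      have : Projective p.shortComplexKer.X₂ :=
        inferInstanceAs (Projective (ModuleCat.of R F))
      obtain ⟨x₁, hx₁⟩ := Ext.contravariant_sequence_exact₃ hS _ x
        (Ext.eq_zero_of_projective _) (add_zero 1)
      obtain ⟨φ, rfl⟩ := (Ext.mk₀_bijective _ _).2 x₁
      obtain ⟨ψ, hψ⟩ := h φ.hom
      have : φ = p.shortComplexKer.f ≫ ModuleCat.ofHom ψ := by
        ext1
        exact hψ.symm
      rw [this, ← Ext.mk₀_comp_mk₀, ShortComplex.ShortExact.extClass_comp_assoc] at hx₁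
      exact hx₁.symm
    rw [key a, key b]

lemma subsingleton_ext_add_two_iff (i : ℕ) :
    Subsingleton (Ext (ModuleCat.of R N) (ModuleCat.of R Y) (i + 2)) ↔
      Subsingleton (Ext (ModuleCat.of R (LinearMap.ker p)) (ModuleCat.of R Y) (i + 1)) := by
  have hS := LinearMap.shortExact_shortComplexKer hp
  have : Projective p.shortComplexKer.X₂ := inferInstanceAs (Projective (ModuleCat.of R F))
  have (m : ℕ) : Subsingleton (Ext p.shortComplexKer.X₂ (ModuleCat.of R Y) (m + 1)) :=
    Ext.subsingleton_of_projective _ _ m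
  have isi : IsIso (AddCommGrpCat.ofHom (hS.extClass.precomp (ModuleCat.of R Y)
      (add_comm 1 (i + 1)))) :=
    (Ext.contravariantSequence_exact hS (ModuleCat.of R Y) (i + 1) (i + 2)
      (add_comm 1 _)).isIso_map' 1 (by decide)
        ((AddCommGrpCat.of _).isZero_of_subsingleton.eq_zero_of_src _)
          ((AddCommGrpCat.of _).isZero_of_subsingleton.eq_zero_of_tgt _)
  exact ((asIso (AddCommGrpCat.ofHom (hS.extClass.precomp (ModuleCat.of R Y)
    (add_comm 1 (i + 1))))).addCommGroupIsoToAddEquiv.subsingleton_congr).symm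

end Ext

/-- Vanishing of `Ext` is preserved by tensoring the second argument with a flat module. -/
lemma subsingleton_ext_lTensor {R : Type u} [CommRing R] [IsNoetherianRing R]
    (M S : Type u) [AddCommGroup M] [Module R M]
    [AddCommGroup S] [Module R S] [Module.Flat R S] (i : ℕ) (N : Type u)
    [AddCommGroup N] [Module R N] [Module.Finite R N]
    (h : Subsingleton (Ext (ModuleCat.of R N) (ModuleCat.of R M) i)) :
    Subsingleton (Ext (ModuleCat.of R N) (ModuleCat.of R (S ⊗[R] M)) i) := by
  induction i generalizing N with
  | zero =>
    rw [subsingleton_ext_zero_iff] at h ⊢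
    exact (lTensorHomToHomLTensor_surjective N M S).subsingleton
  | succ i ih =>
    obtain ⟨b, p, hp⟩ := Module.Finite.exists_fin' R N
    rcases i with - | i
    · rw [zero_add, subsingleton_ext_one_iff hp] at h ⊢
      intro φ
      -- A map from the syzygy into S ⊗ M is a sum of maps s ⊗ g; each g extends to the free module
      -- by hypothesis.
      obtain ⟨w, rfl⟩ := lTensorHomToHomLTensor_surjective (LinearMap.ker p) M S φ
      induction w with
      | zero => exact ⟨0, by simp⟩
      | add t u ht hu =>
        obtain ⟨ψ, hψ⟩ := ht
        obtain ⟨χ, hχ⟩ := hu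
        exact ⟨ψ + χ, by rw [LinearMap.add_comp, hψ, hχ, map_add]⟩
      | tmul s g =>
        obtain ⟨ψ, rfl⟩ := h g
        exact ⟨TensorProduct.mk R S M s ∘ₗ ψ, by ext; simp⟩
    · rw [subsingleton_ext_add_two_iff hp] at h ⊢
      exact ih _ h

/-- Vanishing of `Ext` in a range of degrees passes to the quotient by a regular sequence, here
over an algebra `S`. -/
lemma subsingleton_ext_quotient_of_isWeaklyRegular {R : Type u} [CommRing R]
    (N : Type u) [AddCommGroup N] [Module R N] {S : Type u} [CommRing S] [Algebra R S]
    (xs : List S) (T : Type u) [AddCommGroup T] [Module R T] [Module S T] [IsScalarTower R S T]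
    (hreg : RingTheory.Sequence.IsWeaklyRegular T xs) (n : ℕ)
    (h : ∀ i, n ≤ i → i ≤ n + xs.length →
      Subsingleton (Ext (ModuleCat.of R N) (ModuleCat.of R T) i)) :
    Subsingleton (Ext (ModuleCat.of R N)
      (ModuleCat.of R (T ⧸ (Ideal.ofList xs • ⊤ : Submodule S T))) n) := by
  have transport : ∀ {A B : Type u} [AddCommGroup A] [AddCommGroup B] [Module R A] [Module R B]
      (e : A ≃ₗ[R] B) (i : ℕ), Subsingleton (Ext (ModuleCat.of R N) (ModuleCat.of R A) i) →
      Subsingleton (Ext (ModuleCat.of R N) (ModuleCat.of R B) i) := by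
    intro A B _ _ _ _ e i hA
    refine (Function.Surjective.subsingleton (α := Ext (ModuleCat.of R N) (ModuleCat.of R A) i)
      (f := fun x => x.comp (Ext.mk₀ e.toModuleIso.hom) (add_zero i)) fun y =>
        ⟨y.comp (Ext.mk₀ e.toModuleIso.inv) (add_zero i), ?_⟩)
    change (y.comp _ _).comp _ _ = y
    rw [Ext.comp_assoc_of_third_deg_zero, Ext.mk₀_comp_mk₀, Iso.inv_hom_id, Ext.comp_mk₀_id]
  induction xs generalizing T with
  | nil =>
    refine transport ?_ n (h n le_rfl (by simp))
    refine ((Submodule.quotEquivOfEqBot (Ideal.ofList ([] : List S) • ⊤ : Submodule S T)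
      (by simp)).symm.restrictScalars R)
  | cons x xs ih =>
    rw [RingTheory.Sequence.isWeaklyRegular_cons_iff] at hreg
    refine transport ((Submodule.quotOfListConsSMulTopEquivQuotSMulTopInner T x
      xs).symm.restrictScalars R) n ?_
    -- Ext in degree i of the quotient sits between degrees i and i + 1 of T, so each regular
    -- element shortens the vanishing range by one at the top.
    refine ih (QuotSMulTop x T) hreg.2 fun i hi hi' => ?_
    have hex : Function.Exact ((LinearMap.lsmul S T x).restrictScalars R)
        ((Submodule.mkQ (x • ⊤ : Submodule S T)).restrictScalars R) := fun t => by
      refine (Submodule.Quotient.mk_eq_zero _).trans ?_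
      rw [Submodule.mem_smul_pointwise_iff_exists]
      exact ⟨fun ⟨b, _, hb⟩ => ⟨b, hb⟩, fun ⟨b, hb⟩ => ⟨b, trivial, hb⟩⟩
    have hinj : Function.Injective ((LinearMap.lsmul S T x).restrictScalars R) := hreg.1
    have hsurj : Function.Surjective
        ((Submodule.mkQ (x • ⊤ : Submodule S T)).restrictScalars R) :=
      Submodule.Quotient.mk_surjective (x • ⊤ : Submodule S T)
    have hC := shortExact_of_exact hinj hex hsurj
    rw [List.length_cons] at h
    have zero1 := AddCommGrpCat.isZero_of_iff_subsingleton.mpr (h i hi (by lia))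
    have zero2 := AddCommGrpCat.isZero_of_iff_subsingleton.mpr (h (i + 1) (by lia) (by lia))
    exact AddCommGrpCat.subsingleton_of_isZero <| ShortComplex.Exact.isZero_of_both_zeros
      ((Ext.covariant_sequence_exact₃' (ModuleCat.of R N) hC) i (i + 1) rfl)
      (zero1.eq_zero_of_src _) (zero2.eq_zero_of_tgt _)

lemma subsingleton_ext_of_isDirectSummand {R : Type u} [CommRing R]
    (N : Type u) [AddCommGroup N] [Module R N] {L k : Type u} [AddCommGroup L] [Module R L]
    [AddCommGroup k] [Module R k] (hk : IsDirectSummand R L k) (i : ℕ)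
    (h : Subsingleton (Ext (ModuleCat.of R N) (ModuleCat.of R L) i)) :
    Subsingleton (Ext (ModuleCat.of R N) (ModuleCat.of R k) i) := by
  obtain ⟨P, Q, hPQ, ⟨e⟩⟩ := hk
  let ι : ModuleCat.of R k ⟶ ModuleCat.of R L := ModuleCat.ofHom (P.subtype ∘ₗ e.toLinearMap)
  let π : ModuleCat.of R L ⟶ ModuleCat.of R k :=
    ModuleCat.ofHom (e.symm.toLinearMap ∘ₗ P.projectionOnto Q hPQ)
  have hιπ : ι ≫ π = 𝟙 _ := by
    ext x
    simp [ι, π]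
  refine Function.Surjective.subsingleton (α := Ext (ModuleCat.of R N) (ModuleCat.of R L) i)
      (f := fun x => x.comp (Ext.mk₀ π) (add_zero i)) fun y =>
        ⟨y.comp (Ext.mk₀ ι) (add_zero i), ?_⟩
  simp [Ext.mk₀_comp_mk₀, hιπ]

/-- Over a Noetherian local ring, vanishing of `Extⁿ(N, k)` bounds the projective dimension. -/
lemma hasProjectiveDimensionLT_of_subsingleton_ext_residueField {R : Type u} [CommRing R]
    [IsNoetherianRing R] [IsLocalRing R] (n : ℕ) (N : Type u) [AddCommGroup N] [Module R N]
    [Module.Finite R N]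
    (h : Subsingleton (Ext (ModuleCat.of R N) (ModuleCat.of R (ResidueField R)) n)) :
    HasProjectiveDimensionLT (ModuleCat.of R N) n := by
  induction n generalizing N with
  | zero =>
    rw [subsingleton_ext_zero_iff] at h
    have : Subsingleton N := by
      by_contra hN
      rw [not_subsingleton_iff_nontrivial] at hN
      obtain ⟨W, hW, -⟩ := (eq_top_or_exists_le_coatom (⊥ : Submodule R N)).resolve_left bot_ne_top
      have hsimp : IsSimpleModule R (N ⧸ W) := isSimpleModule_iff_isCoatom.mpr hW
      obtain ⟨I, hI, ⟨e⟩⟩ := isSimpleModule_iff_quot_maximal.mp hsimp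
      obtain rfl := IsLocalRing.eq_maximalIdeal hI
      have hz : (e.toLinearMap ∘ₗ W.mkQ : N →ₗ[R] ResidueField R) = 0 := Subsingleton.elim _ _
      have hs : Function.Surjective (e.toLinearMap ∘ₗ W.mkQ) :=
        e.surjective.comp W.mkQ_surjective
      obtain ⟨x, hx⟩ := hs (1 : ResidueField R)
      have : (e.toLinearMap ∘ₗ W.mkQ) x = (0 : ResidueField R) := LinearMap.congr_fun hz x
      exact one_ne_zero (α := ResidueField R) (hx.symm.trans this)
    exact (ModuleCat.isZero_of_subsingleton (ModuleCat.of R N)).hasProjectiveDimensionLT_zero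
  | succ n ih =>
    obtain ⟨b, p, hp⟩ := Module.Finite.exists_fin' R N
    rcases n with - | n
    · rw [zero_add, subsingleton_ext_one_iff hp] at h
      -- Every functional on k ⊗ ker p factors through k ⊗ F, because maps ker p → k extend to F.
      -- Functionals separate points, so the map is injective, and N is free.
      have hinj : Function.Injective
          ((LinearMap.ker p).subtype.lTensor (ResidueField R)) := by
        rw [← LinearMap.ker_eq_bot, LinearMap.ker_eq_bot']
        intro t ht
        rw [← Module.forall_dual_apply_eq_zero_iff (ResidueField R)]
        intro φ
        obtain ⟨ψ, hψ⟩ := h (φ.restrictScalars R ∘ₗ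
          TensorProduct.mk R (ResidueField R) (LinearMap.ker p) 1)
        let ψ' : ResidueField R ⊗[R] (Fin b → R) →ₗ[R] ResidueField R :=
          TensorProduct.lift ((LinearMap.mul R (ResidueField R)).compl₂ ψ)
        have : ∀ t, φ t = ψ' ((LinearMap.ker p).subtype.lTensor (ResidueField R) t) := by
          intro t
          induction t with
          | zero => simp
          | add t u ht hu => rw [map_add, map_add, map_add, ht, hu]
          | tmul a x =>
            have h1 := LinearMap.congr_fun hψ x
            simp only [LinearMap.comp_apply, LinearMap.restrictScalars_apply, mk_apply] at h1
            simp only [ψ', LinearMap.lTensor_tmul, lift.tmul, LinearMap.compl₂_apply, h1,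
              LinearMap.mul_apply']
            rw [← smul_eq_mul, ← map_smul, TensorProduct.smul_tmul', smul_eq_mul, mul_one]
        rw [this, ht, map_zero]
      have : Module.Free R N := Module.free_of_lTensor_residueField_injective
        (LinearMap.ker p).subtype p hp (LinearMap.exact_subtype_ker_map p) hinj
      have : Projective (ModuleCat.of R N) := inferInstance
      infer_instance
    · rw [subsingleton_ext_add_two_iff hp] at h
      have := ih _ h
      have hS := LinearMap.shortExact_shortComplexKer hp
      have hproj : Projective p.shortComplexKer.X₂ :=
        inferInstanceAs (Projective (ModuleCat.of R (Fin b → R)))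
      exact (hS.hasProjectiveDimensionLT_X₃_iff n hproj).mpr this

lemma exists_fin_span_range_eq {A : Type*} [CommRing A] [IsNoetherianRing A] (I : Ideal A) :
    ∃ (n : ℕ) (y : Fin n → A), n = I.spanFinrank ∧ Ideal.span (Set.range y) = I := by
  obtain ⟨s, hs, hspan⟩ := Submodule.FG.exists_span_finset_card_eq_spanFinrank
    (IsNoetherian.noetherian I)
  refine ⟨s.card, fun i => (s.equivFin.symm i : A), hs, ?_⟩
  have : Set.range (fun i => (s.equivFin.symm i : A)) = s := by
    rw [Set.range_comp' Subtype.val s.equivFin.symm, s.equivFin.symm.range_eq_univ,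
      Set.image_univ, Subtype.range_coe]
  rw [this]
  exact hspan

/-! ### Translating the Cohen–Macaulay and codimension hypotheses -/

section

variable {R : Type u} [CommRing R] [IsNoetherianRing R] [IsLocalRing R]
  {M : Type u} [AddCommGroup M] [Module R M] [Module.Finite R M] [Nontrivial M]

lemma supportDim_eq_dim : Module.supportDim R M = dim R M := by
  have h1 : Module.supportDim R M ≠ ⊥ := Module.supportDim_ne_bot_of_nontrivial R M
  have h2 : Module.supportDim R M < ⊤ := by
    rw [Module.supportDim_eq_ringKrullDim_quotient_annihilator]
    exact ringKrullDim_lt_top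
  rw [dim]
  generalize Module.supportDim R M = a at h1 h2
  induction a with
  | bot => exact absurd rfl h1
  | coe a =>
    induction a with
    | top => exact absurd h2 (lt_irrefl _)
    | coe a => rfl

/-- Depth is only a supremum, so for positive dimension r + 1 one takes a sequence longer than r and
keeps its first r + 1 terms. -/
lemma exists_isRegular_of_isCohenMacaulay (h : IsCohenMacaulay R M) :
    ∃ rs : List R, rs.length = dim R M ∧ (∀ a ∈ rs, a ∈ maximalIdeal R) ∧
      RingTheory.Sequence.IsRegular M rs := by
  rw [IsCohenMacaulay, supportDim_eq_dim] at h
  have h1 : depth R M = dim R M := WithBot.coe_injective h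
  rcases hr : dim R M with - | r
  · exact ⟨[], rfl, by simp, RingTheory.Sequence.IsRegular.nil R M⟩
  · have h2 : (r : ℕ∞) < depth R M := by
      rw [h1, hr]; exact_mod_cast Nat.lt_succ_self r
    rw [depth, lt_iSup_iff] at h2
    obtain ⟨rs, h2⟩ := h2
    rw [lt_iSup_iff] at h2
    obtain ⟨⟨hreg, hmem⟩, h3⟩ := h2
    have h4 : r + 1 ≤ rs.length := by exact_mod_cast h3
    refine ⟨rs.take (r + 1), by simpa using h4, fun a ha => hmem a (List.mem_of_mem_take ha), ?_⟩
    rw [IsLocalRing.isRegular_iff_isWeaklyRegular_of_subset_maximalIdeal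
      (fun a ha => hmem a (List.mem_of_mem_take ha))]
    have h5 := hreg.toIsWeaklyRegular
    rw [← List.take_append_drop (r + 1) rs,
      RingTheory.Sequence.isWeaklyRegular_append_iff] at h5
    exact h5.1

-- The y are lifts of a minimal generating set of the maximal ideal of R/Ann M, whose dimension is
-- that of M.
variable (R M) in
lemma exists_generators_modulo_annihilator :
    ∃ (s : ℕ) (y : Fin s → R),
      maximalIdeal R = Module.annihilator R M ⊔ Ideal.span (Set.range y) ∧
      codim (R ⧸ Module.annihilator R M) = s - dim R M := by
  let A := R ⧸ Module.annihilator R M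
  have hdim : ((ringKrullDim A).unbotD 0).toNat = dim R M := by
    rw [dim, Module.supportDim_eq_ringKrullDim_quotient_annihilator]
  obtain ⟨s, y, hs, hy⟩ := exists_fin_span_range_eq (maximalIdeal A)
  choose y' hy' using fun i => Ideal.Quotient.mk_surjective (I := Module.annihilator R M) (y i)
  refine ⟨_, y', ?_, by rw [codim, hdim, hs]⟩
  have h1 : (Ideal.span (Set.range y')).map (Ideal.Quotient.mk (Module.annihilator R M)) =
      maximalIdeal A := by
    rw [Ideal.map_span, ← hy, ← Set.range_comp]
    congr 2
    exact funext hy'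
  have h2 : (maximalIdeal A).comap (Ideal.Quotient.mk (Module.annihilator R M)) =
      maximalIdeal R := by
    have : IsLocalHom (Ideal.Quotient.mk (Module.annihilator R M)) :=
      IsLocalHom.of_surjective _ Ideal.Quotient.mk_surjective
    exact ((IsLocalRing.local_hom_TFAE (Ideal.Quotient.mk (Module.annihilator R M))).out 0 4).mp this
  rw [← h2, ← h1, Ideal.comap_map_of_surjective' _ Ideal.Quotient.mk_surjective, Ideal.mk_ker,
    sup_comm]

end

end CUlrich

/-! ### The main theorem -/

theorem mainTheorem8 (R : Type u) [CommRing R] [IsNoetherianRing R] [IsLocalRing R]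
    (M : Type u) [AddCommGroup M] [Module R M] [Module.Finite R M] [Nontrivial M]
    (c : ℝ) (hM : CUlrich.IsUlrich R M c)
    (hcv : CUlrich.codim (R ⧸ Module.annihilator R M) = 0 ∨
      c < 1 + 1 / (CUlrich.codim (R ⧸ Module.annihilator R M) : ℝ)) :
    (Infinite (IsLocalRing.ResidueField R) →
      ∃ x : List R, (∀ r ∈ x, r ∈ IsLocalRing.maximalIdeal R) ∧
        RingTheory.Sequence.IsRegular M x ∧
        CUlrich.IsDirectSummand R (M ⧸ (Ideal.ofList x • ⊤ : Submodule R M))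
          (IsLocalRing.ResidueField R)) ∧
    (∀ (N : Type u) [AddCommGroup N] [Module R N] [Module.Finite R N] (n : ℕ),
      (∀ i : ℕ, n ≤ i → i ≤ n + CUlrich.dim R M →
        Subsingleton (Abelian.Ext (ModuleCat.of R N) (ModuleCat.of R M) i)) →
      projectiveDimension (ModuleCat.of R N) < ⊤) := by
  open CUlrich IsLocalRing TensorProduct in
  have hdepth := exists_isRegular_of_isCohenMacaulay hM.isCohenMacaulay
  obtain ⟨s, y, hy, hs⟩ := exists_generators_modulo_annihilator R M
  rw [hs] at hcv
  have hmul : (Nat.factorial (dim R M) : ℝ) *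
      limUnder atTop (fun n : ℕ => (hilbertSamuel R M n : ℝ) / (n : ℝ) ^ dim R M) ≤
      c * hilbertSamuel R M 1 := by
    rw [hilbertSamuel, pow_one]
    exact hM.multiplicity_le
  refine ⟨fun hinf => ?_, fun N _ _ _ n hN => ?_⟩
  · obtain ⟨x, hx, hreg, -, t, ht, ht'⟩ :=
      exists_isRegular_exists_socle supportDim_eq_dim hdepth le_rfl hy hmul hcv
    exact ⟨x, hx, hreg, isDirectSummand_residueField ht ht'⟩
  · obtain ⟨S, _, _, _, _, _, hS, _⟩ := exists_flat_extension_infinite_residueField R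
    obtain ⟨rs, hlen, hrs, hreg⟩ := hdepth
    obtain ⟨hdim', hreg'⟩ := supportDim_baseChange_of_isRegular hS supportDim_eq_dim hlen hreg
    have : Nontrivial (S ⊗[R] M) := hreg'.nontrivial
    have hloc := isLocalHom_of_map_maximalIdeal hS
    have hJ : (Module.annihilator R M).map (algebraMap R S) ≤
        Module.annihilator S (S ⊗[R] M) := by
      rw [Ideal.map_le_iff_le_comap]
      intro a ha
      rw [Ideal.mem_comap, Module.mem_annihilator]
      intro t
      rw [algebraMap_smul]
      induction t with
      | zero => simp
      | add t u ht hu => rw [smul_add, ht, hu, add_zero]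
      | tmul b m =>
        rw [← TensorProduct.tmul_smul, Module.mem_annihilator.mp ha, TensorProduct.tmul_zero]
    -- The count s is unchanged over S, so the numerical hypothesis `hcv` applies there verbatim.
    have hy' : maximalIdeal S = (Module.annihilator R M).map (algebraMap R S) ⊔
        Ideal.span (Set.range (algebraMap R S ∘ y)) := by
      rw [← hS, Set.range_comp, ← Ideal.map_span, ← Ideal.map_sup, ← hy]
    obtain ⟨xs, hxs, hreg2, hlen2, t, ht, ht'⟩ := exists_isRegular_exists_socle hdim'
      ⟨_, by rw [List.length_map, hlen], by
        simp only [List.mem_map]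
        rintro - ⟨a, ha, rfl⟩
        rw [← hS]
        exact Ideal.mem_map_of_mem _ (hrs a ha), hreg'⟩ hJ hy' (c := c)
      (by simpa only [hilbertSamuel_baseChange hS] using hmul) hcv
    -- As xs has length dim M, the degrees n, …, n + dim M are exactly what is needed to reach
    -- degree n.
    have hext := subsingleton_ext_quotient_of_isWeaklyRegular N xs (S ⊗[R] M)
      hreg2.toIsWeaklyRegular n fun i hi hi' =>
        subsingleton_ext_lTensor M S i N (hN i hi (hlen2 ▸ hi'))
    -- Because the maximal ideal of S is generated by 𝔪, both properties of t over S hold over R as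
    -- well, and the summand is the residue field of R.
    have hsum : IsDirectSummand R
        ((S ⊗[R] M) ⧸ (Ideal.ofList xs • ⊤ : Submodule S (S ⊗[R] M))) (ResidueField R) := by
      refine isDirectSummand_residueField (s := t) (fun a ha => ?_) fun h => ht' ?_
      · rw [← algebraMap_smul S a t]
        exact ht _ (hS ▸ Ideal.mem_map_of_mem _ ha)
      · refine Submodule.smul_induction_on h (fun a ha z _ => ?_) fun a b => add_mem
        rw [← algebraMap_smul S a z]
        exact Submodule.smul_mem_smul (hS ▸ Ideal.mem_map_of_mem _ ha) trivial
    have := hasProjectiveDimensionLT_of_subsingleton_ext_residueField n N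
      (subsingleton_ext_of_isDirectSummand N hsum n hext)
    exact lt_of_lt_of_le (projectiveDimension_lt_iff.mpr this) le_top
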